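/- Fix $n\ge 2$ and let $CV_n$ be Outer space of rank $n$: the set of classes of marked metric graphs of rank $n$ (finite connected graphs with all vertices of valence at least three, positive edge lengths and an identification of $F_n$ with the fundamental group), two of them being identified if there is a homothety between them commuting with the markings up to free homotopy. Equip $CV_n$ with the symmetric Lipschitz distance $$d(X,Y)=\log\Big(\sup_{\gamma}\frac{L_X(\gamma)}{L_Y(\gamma)}\cdot\sup_{\gamma}\frac{L_Y(\gamma)}{L_X(\gamma)}\Big),$$ where $\gamma$ runs over the non-trivial elements of $F_n$ and $L_X(\gamma)$ is the length of the shortest loop of $X$ in the free homotopy class of $\gamma$. The (open) simplex of a marked graph is the set of points of $CV_n$ obtained by putting arbitrary positive lengths on its edges. Let $\Delta$ be a multi-theta simplex, i.e. the simplex of a marked graph with exactly two vertices and $n+1$ edges joining them. Its centre is the point at which all edges have the same length. Its rose-faces are the simplices of $CV_n$ whose underlying marked graph is a rose (one vertex, $n$ loops) obtained from the graph of $\Delta$ by collapsing edges. Let $\Delta^*$ be the union of $\Delta$ and its rose-faces. **Theorem.** Let $\Phi$ be an isometry of $\Delta$, i.e. a $d$-preserving bijection $\Delta\to\Delta$. Then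 $\Phi$ fixes the centre of $\Delta$. Moreover, $\Phi$ extends to an isometry of $\Delta^*$ onto itself, and this extension is unique; if it leaves each rose-face of $\Delta$ invariant, that is, maps each rose-face into itself, then it fixes every rose-face pointwise, and $\Phi$ is the identity map of $\Delta$. -/

import Mathlib

/-! ## Finite graphs, edge paths, fundamental groups

A finite graph is given by vertices `V`, edges `E` with an (arbitrary) reference orientation, and the
two end points of each edge.  Loops and multiple edges are allowed.  An oriented edge is a pair in
`E × Bool`, where `(e, true)` is `e` run from `src e` to `tgt e` and `(e, false)` is the reverse. -/

structure FinGraph : Type 1 where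
  V : Type
  E : Type
  finV : Finite V
  finE : Finite E
  src : E → V
  tgt : E → V

namespace FinGraph

/-- Oriented edges. -/
abbrev Dart (X : FinGraph) : Type := X.E × Bool

/-- The same edge with the opposite orientation. -/
def rev (X : FinGraph) (d : X.Dart) : X.Dart := (d.1, !d.2)

/-- Initial vertex of an oriented edge. -/
def init (X : FinGraph) (d : X.Dart) : X.V := if d.2 = true then X.src d.1 else X.tgt d.1

/-- Terminal vertex of an oriented edge. -/
def term (X : FinGraph) (d : X.Dart) : X.V := X.init (X.rev d)

/-- `X.IsPath v p w`: the list `p` of oriented edges is an edge path from `v` to `w`. -/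
def IsPath (X : FinGraph) : X.V → List X.Dart → X.V → Prop
  | v, [], w => v = w
  | v, d :: p, w => X.init d = v ∧ X.IsPath (X.term d) p w

/-- Any two vertices are joined by an edge path. -/
def IsConnected (X : FinGraph) : Prop := ∀ v w, ∃ p, X.IsPath v p w

/-- Number of germs of edges at a vertex (a loop counts twice). -/
noncomputable def valence (X : FinGraph) (v : X.V) : ℕ := Nat.card {d : X.Dart // X.init d = v}

lemma isPath_append (X : FinGraph) {u v w : X.V} {p q : List X.Dart}
    (hp : X.IsPath u p v) (hq : X.IsPath v q w) : X.IsPath u (p ++ q) w := by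
  induction p generalizing u with
  | nil => cases hp; exact hq
  | cons d p ih => exact ⟨hp.1, ih hp.2⟩

lemma rev_rev (X : FinGraph) (d : X.Dart) : X.rev (X.rev d) = d := by
  simp [rev]

lemma isPath_invRev (X : FinGraph) {v w : X.V} {p : List X.Dart}
    (hp : X.IsPath v p w) : X.IsPath w (FreeGroup.invRev p) v := by
  induction p generalizing v with
  | nil => cases hp; rfl
  | cons d p ih =>
    have h1 := ih hp.2
    have h2 : X.IsPath (X.term d) [X.rev d] v := by
      refine ⟨rfl, ?_⟩
      show X.init (X.rev (X.rev d)) = v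
      rw [X.rev_rev]; exact hp.1
    have := X.isPath_append h1 h2
    simpa [FreeGroup.invRev, rev] using this

/-- The fundamental group `π₁(X, v)`.  Two edge paths with the same end points are homotopic relative
to their end points if and only if they differ by insertions and deletions of backtrackings
`d, X.rev d`, that is, if and only if they define the same element of the free group on the set of
edges.  So homotopy classes of closed edge paths at `v` form a subgroup of that free group. -/
def pi1 (X : FinGraph) (v : X.V) : Subgroup (FreeGroup X.E) where
  carrier := {g | ∃ p, X.IsPath v p v ∧ FreeGroup.mk p = g}
  one_mem' := ⟨[], rfl, rfl⟩
  mul_mem' := by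
    rintro _ _ ⟨p, hp, rfl⟩ ⟨q, hq, rfl⟩
    exact ⟨p ++ q, X.isPath_append hp hq, by simp⟩
  inv_mem' := by
    rintro _ ⟨p, hp, rfl⟩
    exact ⟨FreeGroup.invRev p, X.isPath_invRev hp, by simp⟩

/-- Length of an edge path for given edge lengths. -/
def pathLength (X : FinGraph) (len : X.E → ℝ) (p : List X.Dart) : ℝ :=
  (p.map fun d => len d.1).sum

end FinGraph

/-! ## Marked graphs and marked metric graphs -/

/-- A marked graph of rank `n`: a finite connected graph all of whose vertices have valence at least
three, with a marking.  Up to homotopy, a map from the standard rose `R_n` to `X` which induces an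
isomorphism of fundamental groups is the same as a base vertex and an isomorphism from
`F_n = π₁(R_n)` to `π₁(X, base)`, where changing the map by a free homotopy moves the base vertex along
a path. -/
structure MarkedGraph (n : ℕ) extends FinGraph where
  connected : toFinGraph.IsConnected
  three_le_valence : ∀ v, 3 ≤ toFinGraph.valence v
  base : V
  marking : FreeGroup (Fin n) ≃* toFinGraph.pi1 base

/-- A marked metric graph: a marked graph with positive edge lengths. -/
structure MarkedMetricGraph (n : ℕ) where
  graph : MarkedGraph n
  len : graph.E → ℝ
  len_pos : ∀ e, 0 < len e

/-- An isomorphism of the underlying (unmarked, non-metric) graphs. -/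
structure GraphIso (X Y : FinGraph) where
  onV : X.V ≃ Y.V
  onD : X.Dart ≃ Y.Dart
  onD_rev : ∀ d, onD (X.rev d) = Y.rev (onD d)
  init_onD : ∀ d, Y.init (onD d) = onV (X.init d)

namespace GraphIso

/-- The homomorphism induced on homotopy classes of edge paths. -/
def hom {X Y : FinGraph} (φ : GraphIso X Y) : FreeGroup X.E →* FreeGroup Y.E :=
  FreeGroup.lift fun e => FreeGroup.mk [φ.onD (e, true)]

lemma hom_mk {X Y : FinGraph} (φ : GraphIso X Y) (p : List X.Dart) :
    φ.hom (FreeGroup.mk p) = FreeGroup.mk (p.map φ.onD) := by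
  induction p with
  | nil => simp [← FreeGroup.one_eq_mk]
  | cons d p ih =>
    have h1 : ∀ q : List X.Dart, FreeGroup.mk (d :: q) = FreeGroup.mk [d] * FreeGroup.mk q := by
      intro q; simp
    have h2 : FreeGroup.mk (φ.onD d :: p.map φ.onD)
        = FreeGroup.mk [φ.onD d] * FreeGroup.mk (p.map φ.onD) := by simp
    rw [h1, map_mul, ih, List.map_cons, h2]
    congr 1
    obtain ⟨e, b⟩ := d
    cases b with
    | true => simp [hom]
    | false =>
      have h3 : φ.onD (e, false) = Y.rev (φ.onD (e, true)) := by
        rw [← φ.onD_rev]; rfl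
      rw [h3]
      simp [hom, FinGraph.rev, FreeGroup.invRev]

lemma isPath_map {X Y : FinGraph} (φ : GraphIso X Y) {v w : X.V} {p : List X.Dart}
    (hp : X.IsPath v p w) : Y.IsPath (φ.onV v) (p.map φ.onD) (φ.onV w) := by
  induction p generalizing v with
  | nil => cases hp; rfl
  | cons d p ih =>
    refine ⟨by rw [φ.init_onD, hp.1], ?_⟩
    have := ih hp.2
    have h : Y.term (φ.onD d) = φ.onV (X.term d) := by
      rw [FinGraph.term, ← φ.onD_rev, φ.init_onD]; rfl
    rw [h]; exact this

def refl (X : FinGraph) : GraphIso X X := ⟨Equiv.refl _, Equiv.refl _, fun _ => rfl, fun _ => rfl⟩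

def symm {X Y : FinGraph} (φ : GraphIso X Y) : GraphIso Y X where
  onV := φ.onV.symm
  onD := φ.onD.symm
  onD_rev d := by rw [Equiv.symm_apply_eq, φ.onD_rev, Equiv.apply_symm_apply]
  init_onD d := by rw [Equiv.eq_symm_apply, ← φ.init_onD, Equiv.apply_symm_apply]

def trans {X Y Z : FinGraph} (φ : GraphIso X Y) (ψ : GraphIso Y Z) : GraphIso X Z where
  onV := φ.onV.trans ψ.onV
  onD := φ.onD.trans ψ.onD
  onD_rev d := by simp [φ.onD_rev, ψ.onD_rev]
  init_onD d := by simp [φ.init_onD, ψ.init_onD]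

lemma hom_refl (X : FinGraph) (g : FreeGroup X.E) : (refl X).hom g = g := by
  induction g using Quot.inductionOn with
  | h p => exact ((refl X).hom_mk p).trans (by simp [refl])

lemma hom_trans {X Y Z : FinGraph} (φ : GraphIso X Y) (ψ : GraphIso Y Z) (g : FreeGroup X.E) :
    (φ.trans ψ).hom g = ψ.hom (φ.hom g) := by
  induction g using Quot.inductionOn with
  | h p =>
    change (φ.trans ψ).hom (FreeGroup.mk p) = ψ.hom (φ.hom (FreeGroup.mk p))
    rw [hom_mk, hom_mk, hom_mk, List.map_map]; rfl

lemma hom_symm_hom {X Y : FinGraph} (φ : GraphIso X Y) (g : FreeGroup X.E) :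
    φ.symm.hom (φ.hom g) = g := by
  rw [← hom_trans, show φ.trans φ.symm = refl X from ?_, hom_refl]
  simp [trans, symm, refl]

end GraphIso

namespace MarkedGraph

/-- A homomorphism `f` of path classes and a vertex `v` of `Y` (the image of the base vertex of `X`)
carry the marking of `X` to the marking of `Y` up to free homotopy: there is an edge path `r` from the
base vertex of `Y` to `v` such that `τ_Y(w) = r · f(τ_X(w)) · r⁻¹` for all `w ∈ F_n`. -/
def CarriesMarking {n : ℕ} (X Y : MarkedGraph n) (f : FreeGroup X.E →* FreeGroup Y.E) (v : Y.V) :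
    Prop :=
  ∃ r, Y.IsPath Y.base r v ∧ ∀ w : FreeGroup (Fin n),
    (Y.marking w : FreeGroup Y.E)
      = FreeGroup.mk r * f (X.marking w : FreeGroup X.E) * (FreeGroup.mk r)⁻¹

end MarkedGraph

namespace MarkedMetricGraph

variable {n : ℕ}

/-- There is a homothety of ratio `c` from `A` to `B` which commutes with the markings up to free
homotopy.  (As all vertices have valence at least three, homotheties of metric graphs send vertices to
vertices and edges to edges.) -/
def HomothetyRatio (c : ℝ) (A B : MarkedMetricGraph n) : Prop :=
  ∃ φ : GraphIso A.graph.toFinGraph B.graph.toFinGraph,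
    (∀ d : A.graph.Dart, B.len (φ.onD d).1 = c * A.len d.1) ∧
      A.graph.CarriesMarking B.graph φ.hom (φ.onV A.graph.base)

lemma HomothetyRatio.refl (A : MarkedMetricGraph n) : HomothetyRatio 1 A A :=
  ⟨GraphIso.refl _, fun _ => by simp [GraphIso.refl], [], rfl, fun w => by
    rw [GraphIso.hom_refl, ← FreeGroup.one_eq_mk]; simp⟩

lemma HomothetyRatio.symm {c : ℝ} (hc : 0 < c) {A B : MarkedMetricGraph n}
    (h : HomothetyRatio c A B) : HomothetyRatio c⁻¹ B A := by
  obtain ⟨φ, hlen, r, hr, hm⟩ := h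
  refine ⟨φ.symm, fun d => ?_, (FreeGroup.invRev r).map φ.symm.onD, ?_, fun w => ?_⟩
  · have := hlen (φ.onD.symm d)
    rw [Equiv.apply_symm_apply] at this
    rw [this]
    show A.len (φ.onD.symm d).1 = _
    field_simp
  · have h1 := φ.symm.isPath_map (B.graph.isPath_invRev hr)
    have h2 : φ.symm.onV (φ.onV A.graph.base) = A.graph.base := φ.onV.symm_apply_apply _
    rwa [h2] at h1
  · rw [← GraphIso.hom_mk, hm w, ← FreeGroup.inv_mk]
    simp only [map_mul, map_inv, GraphIso.hom_symm_hom]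
    group

lemma HomothetyRatio.trans {c c' : ℝ} {A B C : MarkedMetricGraph n}
    (h : HomothetyRatio c A B) (h' : HomothetyRatio c' B C) : HomothetyRatio (c' * c) A C := by
  obtain ⟨φ, hlen, r, hr, hm⟩ := h
  obtain ⟨ψ, hlen', r', hr', hm'⟩ := h'
  refine ⟨φ.trans ψ, fun d => ?_, r' ++ r.map ψ.onD,
    C.graph.isPath_append hr' (ψ.isPath_map hr), fun w => ?_⟩
  · show C.len (ψ.onD (φ.onD d)).1 = _
    rw [hlen', hlen, mul_assoc]
  · rw [hm' w, hm w, ← FreeGroup.mul_mk, ← GraphIso.hom_mk, GraphIso.hom_trans]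
    simp only [map_mul, map_inv]
    group

/-- Two marked metric graphs are equivalent if there is a homothety between them which commutes with
the markings up to free homotopy. -/
def equivalence (n : ℕ) : Setoid (MarkedMetricGraph n) where
  r A B := ∃ c : ℝ, 0 < c ∧ HomothetyRatio c A B
  iseqv :=
    { refl := fun A => ⟨1, one_pos, HomothetyRatio.refl A⟩
      symm := fun ⟨_, hc, h⟩ => ⟨_, inv_pos.2 hc, h.symm hc⟩
      trans := fun ⟨_, hc, h⟩ ⟨_, hc', h'⟩ => ⟨_, mul_pos hc' hc, h.trans h'⟩ }

/-- The lengths of the closed edge paths `p` of `A` in the free homotopy class of `τ_A(w)`. -/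
def loopLengths (A : MarkedMetricGraph n) (w : FreeGroup (Fin n)) : Set ℝ :=
  {l | ∃ (v : A.graph.V) (p r : List A.graph.Dart), A.graph.IsPath v p v ∧
    A.graph.IsPath A.graph.base r v ∧
    (A.graph.marking w : FreeGroup A.graph.E)
      = FreeGroup.mk r * FreeGroup.mk p * (FreeGroup.mk r)⁻¹ ∧
    l = A.graph.pathLength A.len p}

/-- `L_A(w)`: the length of the shortest closed edge path in the free homotopy class of `τ_A(w)`. -/
noncomputable def translationLength (A : MarkedMetricGraph n) (w : FreeGroup (Fin n)) : ℝ :=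
  sInf (A.loopLengths w)

/-- The stretching factor `sup_γ L_B(γ) / L_A(γ)` over the non-trivial `γ ∈ F_n`. -/
noncomputable def stretch (A B : MarkedMetricGraph n) : ℝ :=
  ⨆ w : {w : FreeGroup (Fin n) // w ≠ 1}, B.translationLength w / A.translationLength w

/-- The symmetric Lipschitz distance. -/
noncomputable def lipDist (A B : MarkedMetricGraph n) : ℝ :=
  Real.log (stretch B A * stretch A B)

lemma HomothetyRatio.loopLengths_subset {c : ℝ} {A B : MarkedMetricGraph n}
    (h : HomothetyRatio c A B) (w : FreeGroup (Fin n)) {l : ℝ} (hl : l ∈ A.loopLengths w) :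
    c * l ∈ B.loopLengths w := by
  obtain ⟨φ, hlen, r, hr, hm⟩ := h
  obtain ⟨v, p, q, hp, hq, hw, rfl⟩ := hl
  refine ⟨φ.onV v, p.map φ.onD, r ++ q.map φ.onD, φ.isPath_map hp,
    B.graph.isPath_append hr (φ.isPath_map hq), ?_, ?_⟩
  · rw [hm w, hw, ← FreeGroup.mul_mk, ← GraphIso.hom_mk, ← GraphIso.hom_mk]
    simp only [map_mul, map_inv]
    group
  · simp only [FinGraph.pathLength, List.map_map]
    rw [← List.sum_map_mul_left]
    congr 1
    exact List.map_congr_left fun d _ => (hlen d).symm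

open scoped Pointwise in
lemma HomothetyRatio.translationLength_eq {c : ℝ} (hc : 0 < c) {A B : MarkedMetricGraph n}
    (h : HomothetyRatio c A B) (w : FreeGroup (Fin n)) :
    B.translationLength w = c * A.translationLength w := by
  have : B.loopLengths w = c • A.loopLengths w := by
    ext l
    rw [Set.mem_smul_set]
    constructor
    · intro hl
      refine ⟨c⁻¹ * l, (h.symm hc).loopLengths_subset w hl, ?_⟩
      rw [smul_eq_mul]; field_simp
    · rintro ⟨l, hl, rfl⟩
      exact h.loopLengths_subset w hl
  rw [translationLength, this, Real.sInf_smul_of_nonneg hc.le]; rfl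

lemma HomothetyRatio.stretch_eq {c c' : ℝ} (hc : 0 < c) (hc' : 0 < c')
    {A B A' B' : MarkedMetricGraph n} (h : HomothetyRatio c A A') (h' : HomothetyRatio c' B B') :
    stretch A' B' = (c' / c) * stretch A B := by
  rw [stretch, stretch, Real.mul_iSup_of_nonneg (by positivity)]
  congr 1
  funext w
  rw [h.translationLength_eq hc, h'.translationLength_eq hc', mul_div_mul_comm]

end MarkedMetricGraph

/-! ## Outer space, its simplices and their faces -/

/-- Outer space of rank `n`: equivalence classes of marked metric graphs of rank `n`. -/
def CV (n : ℕ) : Type 1 := Quotient (MarkedMetricGraph.equivalence n)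

namespace CV

/-- The class of a marked metric graph. -/
def mk {n : ℕ} (A : MarkedMetricGraph n) : CV n := Quotient.mk (MarkedMetricGraph.equivalence n) A

/-- The symmetric Lipschitz distance
`d(X, Y) = log (sup_γ (L_X(γ) / L_Y(γ)) * sup_γ (L_Y(γ) / L_X(γ)))` on outer space. -/
noncomputable def lipDist {n : ℕ} : CV n → CV n → ℝ :=
  Quotient.lift₂ MarkedMetricGraph.lipDist (by
    rintro A B A' B' ⟨c, hc, h⟩ ⟨c', hc', h'⟩
    rw [MarkedMetricGraph.lipDist, MarkedMetricGraph.lipDist, h.stretch_eq hc hc' h',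
      h'.stretch_eq hc' hc h]
    congr 1
    field_simp)

/-- An isometry of a subset `S` of outer space: a distance-preserving bijection of `S`. -/
def IsIsometryOf {n : ℕ} (S : Set (CV n)) (Φ : S → S) : Prop :=
  Function.Bijective Φ ∧ ∀ x y : S, lipDist (Φ x : CV n) (Φ y) = lipDist (x : CV n) y

end CV

namespace MarkedGraph

variable {n : ℕ}

/-- The open simplex of outer space with underlying marked graph `X`: the classes of all metrics
on `X`. -/
def simplex (X : MarkedGraph n) : Set (CV n) :=
  {x | ∃ (len : X.E → ℝ) (hlen : ∀ e, 0 < len e), x = CV.mk ⟨X, len, hlen⟩}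

/-- The centre of the simplex of `X`: all edges have the same length. -/
def centre (X : MarkedGraph n) : X.simplex :=
  ⟨CV.mk ⟨X, fun _ => 1, fun _ => one_pos⟩, fun _ => 1, fun _ => one_pos, rfl⟩

/-- Multi-theta graphs: two vertices, and `n + 1` edges joining them. -/
def IsMultiTheta (X : MarkedGraph n) : Prop :=
  Nat.card X.V = 2 ∧ Nat.card X.E = n + 1 ∧ ∀ e, X.src e ≠ X.tgt e

/-- Roses: one vertex, and `n` petals. -/
def IsRose (X : MarkedGraph n) : Prop :=
  Nat.card X.V = 1 ∧ Nat.card X.E = n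

/-- A combinatorial presentation of `Y` as the graph obtained from `X` by collapsing the edges in `S`:
the oriented edges of `Y` are those of `X` which are not in `S`, and the vertices of `Y` are those
of `X`, with two of them identified if they are joined by an edge path in `S`. -/
structure CollapseMap (X Y : FinGraph) (S : Set X.E) where
  onV : X.V → Y.V
  onD : {d : X.Dart // d.1 ∉ S} ≃ Y.Dart
  onD_rev : ∀ d : {d : X.Dart // d.1 ∉ S}, onD ⟨X.rev d, d.2⟩ = Y.rev (onD d)
  init_onD : ∀ d, Y.init (onD d) = onV (X.init d)
  onV_surjective : Function.Surjective onV
  onV_eq_iff : ∀ v w, onV v = onV w ↔ ∃ p, X.IsPath v p w ∧ ∀ d ∈ p, d.1 ∈ S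

open Classical in
/-- The homomorphism induced by a collapse on homotopy classes of edge paths: collapsed edges are sent
to trivial paths. -/
noncomputable def CollapseMap.hom {X Y : FinGraph} {S : Set X.E} (κ : CollapseMap X Y S) :
    FreeGroup X.E →* FreeGroup Y.E :=
  FreeGroup.lift fun e => if h : e ∈ S then 1 else FreeGroup.mk [κ.onD ⟨(e, true), h⟩]

/-- The marked graph `Y` is obtained from the marked graph `X` by collapsing the edges in `S`. As both
markings are isomorphisms, this forces `S` to be a forest. -/
def IsCollapse (X Y : MarkedGraph n) (S : Set X.E) : Prop :=
  ∃ κ : CollapseMap X.toFinGraph Y.toFinGraph S,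
    X.CarriesMarking Y κ.hom (κ.onV X.base)

/-- `R` is a rose-face of the simplex of `X`: a simplex of outer space whose underlying marked graph is
a rose obtained from `X` by collapsing some edges. -/
def IsRoseFace (X : MarkedGraph n) (R : Set (CV n)) : Prop :=
  ∃ Y : MarkedGraph n, Y.IsRose ∧ (∃ S : Set X.E, X.IsCollapse Y S) ∧ R = Y.simplex

/-- The simplex of `X` together with all its rose-faces. -/
def simplexWithRoseFaces (X : MarkedGraph n) : Set (CV n) :=
  X.simplex ∪ {x | ∃ R, X.IsRoseFace R ∧ x ∈ R}

/-- `Ψ` is an extension of the self-map `Φ` of the open simplex of `X` to an isometry of the simplex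
together with its rose-faces. -/
def IsIsometricExtension (X : MarkedGraph n) (Φ : X.simplex → X.simplex)
    (Ψ : X.simplexWithRoseFaces → X.simplexWithRoseFaces) : Prop :=
  CV.IsIsometryOf X.simplexWithRoseFaces Ψ ∧
    ∀ x : X.simplex, (Ψ ⟨x, Or.inl x.2⟩ : CV n) = Φ x

end MarkedGraph

/-! In a multi-theta graph a loop goes out along one edge and back along another, again and again,
so after removal of backtracking it is a chain of two-edge loops. Hence the two-edge loops suffice
to compute stretching factors: a stretching factor is the largest ratio of pair sums a_i + a_j. It
follows that the symmetric distance is the sup distance between the vectors of differences of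
logarithms of pair sums (`MarkedMetricGraph.lipDist_eq_dist`). Collapsing an edge `e` onto a rose
amounts to putting a_e = 0 in the same formulas (`represents_petalRose`). So the simplex with its
rose-faces is isometric to the image under `logRatios` of the nonnegative vectors with at most one
zero coordinate.

This image is closed in a finite-dimensional space (`isClosed_image_logRatios`) and the positive
vectors are dense in it. Thus the simplex with its rose-faces is the completion of the open simplex,
which gives existence and uniqueness of the extension (`exists_isometryEquiv_extending`). The
extension preserves the open simplex, hence also its complement, a disjoint union of finitely many
closed connected faces; so it permutes the faces (`exists_image_vanishingFace`).

The distance from a to the face of `e` is log(1 + 2 a_e / m_e), where m_e is the least pair sum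
avoiding `e` (`infDist_logRatios`). The quotients a_e / m_e determine a up to scaling
(`exists_smul_of_div_minAway_eq`), so a point is determined by its distances to the faces. The
centre is at distance log 2 from every face, so no permutation of the faces can move it. If every
face is invariant, all these distances are preserved and the isometry is the identity. -/

/-! ## Pair sums of edge lengths -/

/-- Ordered pairs of distinct elements. -/
abbrev OffDiag (E : Type) : Type := {p : E × E // p.1 ≠ p.2}

/-- Nonnegative vectors with at most one zero coordinate. -/
structure IsAdmissible {E : Type} (a : E → ℝ) : Prop where
  nonneg : ∀ i, 0 ≤ a i
  add_pos : ∀ i j, i ≠ j → 0 < a i + a j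

/-- The sum of the two coordinates indexed by a pair. -/
def pairSum {E : Type} (a : E → ℝ) (p : OffDiag E) : ℝ := a p.1.1 + a p.1.2

/-- The differences of the logarithms of the pair sums. -/
noncomputable def logRatios {E : Type} (a : E → ℝ) (q : OffDiag E × OffDiag E) : ℝ :=
  Real.log (pairSum a q.1) - Real.log (pairSum a q.2)

/-- The least sum of two coordinates with indices different from `e`. -/
noncomputable def minAway {E : Type} (a : E → ℝ) (e : E) : ℝ :=
  ⨅ p : {p : OffDiag E // p.1.1 ≠ e ∧ p.1.2 ≠ e}, pairSum a p.1

/-! ### Log-ratios of pair sums: scaling, continuity, closed image -/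

section Model

variable {E : Type}

lemma isAdmissible_of_pos {a : E → ℝ} (h : ∀ i, 0 < a i) : IsAdmissible a :=
  ⟨fun i => (h i).le, fun i j _ => add_pos (h i) (h j)⟩

lemma IsAdmissible.pairSum_pos {a : E → ℝ} (ha : IsAdmissible a) (p : OffDiag E) :
    0 < pairSum a p := ha.add_pos _ _ p.2

lemma pairSum_smul (c : ℝ) (a : E → ℝ) (p : OffDiag E) :
    pairSum (c • a) p = c * pairSum a p := by
  simp [pairSum, mul_add]

lemma logRatios_smul {c : ℝ} (hc : 0 < c) {a : E → ℝ} (ha : IsAdmissible a) :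
    logRatios (c • a) = logRatios a := by
  funext q
  simp only [logRatios, pairSum_smul]
  rw [Real.log_mul hc.ne' (ha.pairSum_pos _).ne', Real.log_mul hc.ne' (ha.pairSum_pos _).ne']
  ring

lemma continuousOn_logRatios : ContinuousOn logRatios {a : E → ℝ | IsAdmissible a} := by
  refine continuousOn_pi.2 fun q => ?_
  have h : ∀ p : OffDiag E, ContinuousOn (fun a : E → ℝ => Real.log (pairSum a p))
      {a : E → ℝ | IsAdmissible a} := fun p => by
    refine ContinuousOn.log (Continuous.continuousOn ?_) fun a ha => (ha.pairSum_pos p).ne'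
    unfold pairSum
    fun_prop
  exact (h q.1).sub (h q.2)

/-- Admissible vectors are limits of positive ones. -/
lemma logRatios_mem_closure {a : E → ℝ} (ha : IsAdmissible a) :
    logRatios a ∈ closure (logRatios '' {b : E → ℝ | ∀ i, 0 < b i}) := by
  refine ((continuousOn_logRatios a ha).mono fun b hb =>
    isAdmissible_of_pos hb).mem_closure_image ?_
  have h1 : Filter.Tendsto (fun n : ℕ => fun i => a i + 1 / ((n : ℝ) + 1)) Filter.atTop
      (nhds a) := tendsto_pi_nhds.2 fun i => by
    simpa using tendsto_const_nhds.add (tendsto_one_div_add_atTop_nhds_zero_nat (𝕜 := ℝ))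
  exact mem_closure_of_tendsto h1 (Filter.Eventually.of_forall fun n i =>
    add_pos_of_nonneg_of_pos (ha.nonneg i) Nat.one_div_pos_of_nat)

/-- The admissible vectors vanishing at `e` form a convex set. Connectedness is what later prevents
an isometry from spreading one face over several. -/
lemma isPreconnected_image_logRatios (e : E) :
    IsPreconnected (logRatios '' {a : E → ℝ | IsAdmissible a ∧ a e = 0}) := by
  refine IsPreconnected.image (Convex.isPreconnected ?_) _
    (continuousOn_logRatios.mono fun a ha => ha.1)
  rintro a ⟨ha, ha0⟩ b ⟨hb, hb0⟩ s t hs ht hst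
  refine ⟨⟨fun i => ?_, fun i j hij => ?_⟩, ?_⟩
  · have := ha.nonneg i
    have := hb.nonneg i
    simp only [Pi.add_apply, Pi.smul_apply, smul_eq_mul]
    positivity
  · have h1 := ha.add_pos i j hij
    have h2 := hb.add_pos i j hij
    simp only [Pi.add_apply, Pi.smul_apply, smul_eq_mul]
    rcases hs.eq_or_lt with rfl | hs
    · obtain rfl : t = 1 := by linarith
      linarith
    · nlinarith [mul_pos hs h1, mul_nonneg ht h2.le]
  · simp [ha0, hb0]

lemma minAway_smul {c : ℝ} (hc : 0 ≤ c) (a : E → ℝ) (e : E) :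
    minAway (c • a) e = c * minAway a e := by
  rw [minAway, minAway, Real.mul_iInf_of_nonneg hc]
  simp only [pairSum_smul]

variable [Finite E]

lemma exists_two_ne (hE : 3 ≤ Nat.card E) (i : E) : ∃ j k, j ≠ i ∧ k ≠ i ∧ j ≠ k := by
  have := Fintype.ofFinite E
  rw [Nat.card_eq_fintype_card] at hE
  obtain ⟨a, b, c, hab, hac, hbc⟩ := Fintype.two_lt_card_iff.1 (show 2 < Fintype.card E by omega)
  by_cases ha : a = i
  · exact ⟨b, c, by rintro rfl; exact hab ha, by rintro rfl; exact hac ha, hbc⟩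
  by_cases hb : b = i
  · exact ⟨a, c, ha, by rintro rfl; exact hbc hb, hac⟩
  · exact ⟨a, b, ha, hb, hab⟩

lemma nonempty_offDiag (hE : 3 ≤ Nat.card E) : Nonempty (OffDiag E) := by
  have : Nonempty E := (Nat.card_pos_iff.1 (by omega)).1
  obtain ⟨j, k, -, -, h⟩ := exists_two_ne hE (Classical.arbitrary E)
  exact ⟨⟨(j, k), h⟩⟩

/-- The pair sums determine the coordinates. -/
lemma eq_of_pairSum_eq (hE : 3 ≤ Nat.card E) {a b : E → ℝ}
    (h : ∀ p, pairSum a p = pairSum b p) : a = b := by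
  funext i
  -- In a triple, 2 a_i = (a_i + a_j) + (a_i + a_k) - (a_j + a_k); this is where three indices are
  -- needed.
  obtain ⟨j, k, hj, hk, hjk⟩ := exists_two_ne hE i
  have h1 := h ⟨(i, j), hj.symm⟩
  have h2 := h ⟨(i, k), hk.symm⟩
  have h3 := h ⟨(j, k), hjk⟩
  simp only [pairSum] at h1 h2 h3
  linarith

/-- Equal log-ratios make the pair sums proportional, with the factor read off at any one pair, and
the pair sums determine the vector linearly. -/
lemma exists_smul_of_logRatios_eq (hE : 3 ≤ Nat.card E) {a b : E → ℝ} (ha : IsAdmissible a)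
    (hb : IsAdmissible b) (h : logRatios a = logRatios b) : ∃ c : ℝ, 0 < c ∧ b = c • a := by
  obtain ⟨p₀⟩ := nonempty_offDiag hE
  refine ⟨pairSum b p₀ / pairSum a p₀, div_pos (hb.pairSum_pos _) (ha.pairSum_pos _),
    eq_of_pairSum_eq hE fun p => ?_⟩
  have h1 := congrFun h (p, p₀)
  simp only [logRatios] at h1
  rw [← Real.log_div (ha.pairSum_pos _).ne' (ha.pairSum_pos _).ne',
    ← Real.log_div (hb.pairSum_pos _).ne' (hb.pairSum_pos _).ne'] at h1
  have h2 := Real.log_injOn_pos (div_pos (ha.pairSum_pos p) (ha.pairSum_pos p₀))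
    (div_pos (hb.pairSum_pos p) (hb.pairSum_pos p₀)) h1
  rw [pairSum_smul]
  have := ha.pairSum_pos p₀
  have := hb.pairSum_pos p₀
  field_simp at h2 ⊢
  linarith

/-- The image of the admissible vectors is closed. -/
lemma isClosed_image_logRatios (hE : 3 ≤ Nat.card E) :
    IsClosed (logRatios '' {a : E → ℝ | IsAdmissible a}) := by
  obtain ⟨p₀⟩ := nonempty_offDiag hE
  choose j k hj hk hjk using fun i : E => exists_two_ne hE i
  -- A continuous left inverse, normalised so that the pair sum at `p₀` is 1: `x` recovers the pair
  -- sums and `α` the coordinates.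
  let x : (OffDiag E × OffDiag E → ℝ) → OffDiag E → ℝ := fun u p => Real.exp (u (p, p₀))
  let α : (OffDiag E × OffDiag E → ℝ) → E → ℝ := fun u i =>
    (x u ⟨(i, j i), (hj i).symm⟩ + x u ⟨(i, k i), (hk i).symm⟩ - x u ⟨(j i, k i), hjk i⟩) / 2
  have hx : ∀ p, Continuous fun u => x u p := fun p => by fun_prop
  have hα : ∀ i, Continuous fun u => α u i := fun i => by fun_prop
  -- All conditions here are closed. The open condition that pair sums be positive comes for free,
  -- as they are exponentials.
  have key : logRatios '' {a : E → ℝ | IsAdmissible a} =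
      (⋂ i, {u | 0 ≤ α u i}) ∩ (⋂ p, {u | pairSum (α u) p = x u p}) ∩
        ⋂ q : OffDiag E × OffDiag E, {u | u q = u (q.1, p₀) - u (q.2, p₀)} := by
    ext u
    simp only [Set.mem_inter_iff, Set.mem_iInter, Set.mem_ofPred_eq, Set.mem_image]
    constructor
    · rintro ⟨a, ha, rfl⟩
      have h1 : ∀ p, x (logRatios a) p = pairSum a p / pairSum a p₀ := fun p => by
        simp only [x, logRatios]
        rw [Real.exp_sub, Real.exp_log (ha.pairSum_pos _), Real.exp_log (ha.pairSum_pos _)]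
      have h2 : ∀ i, α (logRatios a) i = a i / pairSum a p₀ := fun i => by
        simp only [α, h1]
        simp only [pairSum]
        ring
      refine ⟨⟨fun i => ?_, fun p => ?_⟩, fun q => ?_⟩
      · rw [h2]; exact div_nonneg (ha.nonneg i) (ha.pairSum_pos _).le
      · rw [h1, pairSum, h2, h2, ← add_div]; rfl
      · simp only [logRatios]; ring
    · rintro ⟨⟨h1, h2⟩, h3⟩
      refine ⟨α u, ⟨h1, fun i j hij => ?_⟩, ?_⟩
      · have := h2 ⟨(i, j), hij⟩
        simp only [pairSum] at this
        rw [this]; exact Real.exp_pos _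
      · funext q
        rw [h3 q]
        simp only [logRatios, h2, x, Real.log_exp]
  rw [key]
  refine ((isClosed_iInter fun i => isClosed_le continuous_const (hα i)).inter
    (isClosed_iInter fun p => isClosed_eq ?_ (hx p))).inter
    (isClosed_iInter fun q => isClosed_eq (by fun_prop) (by fun_prop))
  exact (hα _).add (hα _)

/-! ### The least pair sum away from an index -/

lemma nonempty_away (hE : 3 ≤ Nat.card E) (e : E) :
    Nonempty {p : OffDiag E // p.1.1 ≠ e ∧ p.1.2 ≠ e} := by
  obtain ⟨j, k, hj, hk, hjk⟩ := exists_two_ne hE e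
  exact ⟨⟨⟨(j, k), hjk⟩, hj, hk⟩⟩

lemma minAway_le (a : E → ℝ) (e : E) {j k : E} (hj : j ≠ e) (hk : k ≠ e) (hjk : j ≠ k) :
    minAway a e ≤ a j + a k :=
  ciInf_le (Set.finite_range _).bddBelow
    (⟨⟨(j, k), hjk⟩, hj, hk⟩ : {p : OffDiag E // p.1.1 ≠ e ∧ p.1.2 ≠ e})

lemma exists_minAway_eq (hE : 3 ≤ Nat.card E) (a : E → ℝ) (e : E) :
    ∃ j k, j ≠ e ∧ k ≠ e ∧ j ≠ k ∧ a j + a k = minAway a e := by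
  have := nonempty_away hE e
  obtain ⟨⟨⟨⟨j, k⟩, hjk⟩, hj, hk⟩, h⟩ := exists_eq_ciInf_of_finite
    (f := fun p : {p : OffDiag E // p.1.1 ≠ e ∧ p.1.2 ≠ e} => pairSum a p.1)
  exact ⟨j, k, hj, hk, hjk, h⟩

lemma minAway_pos (hE : 3 ≤ Nat.card E) {a : E → ℝ} (ha : IsAdmissible a) (e : E) :
    0 < minAway a e := by
  obtain ⟨j, k, -, -, hjk, h⟩ := exists_minAway_eq hE a e
  rw [← h]; exact ha.add_pos _ _ hjk

lemma le_minAway (hE : 3 ≤ Nat.card E) {a : E → ℝ} {e : E} {c : ℝ}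
    (h : ∀ j k, j ≠ e → k ≠ e → j ≠ k → c ≤ a j + a k) : c ≤ minAway a e := by
  obtain ⟨j, k, hj, hk, hjk, h'⟩ := exists_minAway_eq hE a e
  rw [← h']; exact h j k hj hk hjk

/-- Auxiliary form of `eq_smul_of_div_minAway_eq`, for vectors whose pair sums compare. -/
lemma eq_of_div_minAway_eq (hE : 3 ≤ Nat.card E) {a b : E → ℝ} (ha : IsAdmissible a)
    (hb : IsAdmissible b) (h : ∀ e, a e / minAway a e = b e / minAway b e)
    (hle : ∀ p, pairSum b p ≤ pairSum a p) {p₀ : OffDiag E} (hp₀ : pairSum b p₀ = pairSum a p₀) :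
    a = b := by
  have hm : ∀ e, minAway b e ≤ minAway a e := fun e => by
    obtain ⟨j, k, hj, hk, hjk, h'⟩ := exists_minAway_eq hE a e
    rw [← h']
    exact (minAway_le b e hj hk hjk).trans (hle ⟨(j, k), hjk⟩)
  have h' : ∀ e, a e * minAway b e = b e * minAway a e := fun e => by
    have := h e
    rwa [div_eq_div_iff (minAway_pos hE ha e).ne' (minAway_pos hE hb e).ne'] at this
  -- Since the quotients agree and the minima of `b` are at most those of `a`, the coordinates
  -- compare as the pair sums do.
  have hba : ∀ e, b e ≤ a e := fun e => by
    have h1 := minAway_pos hE ha e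
    have h2 : b e * minAway a e ≤ a e * minAway a e := by
      rw [← h' e]; exact mul_le_mul_of_nonneg_left (hm e) (ha.nonneg e)
    exact le_of_mul_le_mul_right h2 h1
  have pairEq : ∀ j k, b j + b k = a j + a k → b j = a j ∧ b k = a k := fun j k hjk =>
    ⟨by linarith [hba j, hba k], by linarith [hba j, hba k]⟩
  have hmEq : ∀ e, b e = a e → 0 < a e → minAway b e = minAway a e := fun e he hpos => by
    have := h' e
    rw [he] at this
    exact mul_left_cancel₀ hpos.ne' this
  -- Agreement at a positive coordinate `e` forces equal minima away from `e`. On a pair realising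
  -- the minimum of `a`, the sum of `b` is then squeezed to that of `a`, so the vectors agree on
  -- this pair too.
  have spread : ∀ e, b e = a e → 0 < a e → ∃ j k, j ≠ e ∧ k ≠ e ∧ j ≠ k ∧ b j = a j ∧ b k = a k ∧
      a j + a k = minAway a e := fun e he hpos => by
    obtain ⟨j, k, hj, hk, hjk, hjk'⟩ := exists_minAway_eq hE a e
    have h1 := minAway_le b e hj hk hjk
    rw [hmEq e he hpos, ← hjk'] at h1
    obtain ⟨h2, h3⟩ := pairEq j k (le_antisymm (hle ⟨(j, k), hjk⟩) h1)
    exact ⟨j, k, hj, hk, hjk, h2, h3, hjk'⟩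
  obtain ⟨i, hi, hipos⟩ : ∃ i, b i = a i ∧ 0 < a i := by
    obtain ⟨h1, h2⟩ := pairEq _ _ hp₀
    by_contra! hcon
    have h3 := hcon _ h1
    have h4 := hcon _ h2
    have := ha.pairSum_pos p₀
    simp only [pairSum] at this
    linarith
  -- There are now three distinct indices of agreement: `i`, `k` and `l`.
  obtain ⟨k, l, hki, hli, hkl, hk, hl, -⟩ := spread i hi hipos
  funext e
  by_contra hne
  have hZ : ∀ z, b z = a z → z ≠ e := by rintro z hz rfl; exact hne hz.symm
  -- The minimal pair away from `z` consists of indices of agreement, so it avoids the index `e` of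
  -- disagreement and competes in `minAway a e`.
  have bound : ∀ z, b z = a z → 0 < a z → ∀ x y, x ≠ z → y ≠ z → x ≠ y →
      minAway a e ≤ b x + b y := fun z hz hpos x y hx hy hxy => by
    obtain ⟨s, t, -, -, hst, hs, ht, hmin⟩ := spread z hz hpos
    calc minAway a e ≤ a s + a t := minAway_le a e (hZ s hs) (hZ t ht) hst
      _ = minAway b z := by rw [hmin, hmEq z hz hpos]
      _ ≤ b x + b y := minAway_le b z hx hy hxy
  have inZ : ∀ x y, b x = a x → b y = a y → x ≠ y → minAway a e ≤ b x + b y :=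
    fun x y hx hy hxy => by
      rw [hx, hy]; exact minAway_le a e (hZ x hx) (hZ y hy) hxy
  -- A pair missing `i` is bounded through `i`. A pair containing `i` either lies inside the triple
  -- of agreement or misses both `k` and `l`, one of which is positive. Equal minima at `e` then
  -- contradict the disagreement there.
  have hge : minAway a e ≤ minAway b e := le_minAway hE fun x y _ _ hxy => by
    by_cases hix : x = i ∨ y = i
    · -- a second element of the triple is avoided
      by_cases hkx : x = k ∨ y = k
      · rcases hix with rfl | rfl <;> rcases hkx with rfl | rfl
        · exact absurd rfl hki
        · exact inZ _ _ hi hk hxy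
        · exact inZ _ _ hk hi hxy
        · exact absurd rfl hki
      by_cases hlx : x = l ∨ y = l
      · rcases hix with rfl | rfl <;> rcases hlx with rfl | rfl
        · exact absurd rfl hli
        · exact inZ _ _ hi hl hxy
        · exact inZ _ _ hl hi hxy
        · exact absurd rfl hli
      push Not at hkx hlx
      rcases (ha.nonneg k).eq_or_lt with hk0 | hkpos
      · have hlpos : 0 < a l := by have := ha.add_pos k l hkl; linarith
        exact bound l hl hlpos x y hlx.1 hlx.2 hxy
      · exact bound k hk hkpos x y hkx.1 hkx.2 hxy
    · push Not at hix
      exact bound i hi hipos x y hix.1 hix.2 hxy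
  have h1 := h' e
  rw [le_antisymm (hm e) hge] at h1
  exact hne (mul_right_cancel₀ (minAway_pos hE ha e).ne' h1)

/-- The quotients `a e / minAway a e` determine an admissible vector up to scaling. -/
lemma exists_smul_of_div_minAway_eq (hE : 3 ≤ Nat.card E) {a b : E → ℝ} (ha : IsAdmissible a)
    (hb : IsAdmissible b) (h : ∀ e, a e / minAway a e = b e / minAway b e) :
    ∃ c : ℝ, 0 < c ∧ b = c • a := by
  have := nonempty_offDiag hE
  -- Scaling `a` by the largest ratio makes its pair sums dominate those of `b`, with equality at
  -- `p₀`.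
  obtain ⟨p₀, hp₀⟩ := Finite.exists_max fun p => pairSum b p / pairSum a p
  have hc : 0 < pairSum b p₀ / pairSum a p₀ := div_pos (hb.pairSum_pos _) (ha.pairSum_pos _)
  refine ⟨_, hc, ?_⟩
  have hsm : IsAdmissible ((pairSum b p₀ / pairSum a p₀) • a) :=
    ⟨fun i => mul_nonneg hc.le (ha.nonneg i), fun i j hij => by
      have := mul_pos hc (ha.add_pos i j hij)
      simpa [mul_add] using this⟩
  refine (eq_of_div_minAway_eq hE hsm hb (fun e => ?_) (fun p => ?_) (p₀ := p₀) ?_).symm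
  · rw [minAway_smul hc.le, ← h e, Pi.smul_apply, smul_eq_mul, mul_div_mul_left _ _ hc.ne']
  · rw [pairSum_smul, ← div_le_iff₀ (ha.pairSum_pos p)]
    exact hp₀ p
  · rw [pairSum_smul, div_mul_cancel₀ _ (ha.pairSum_pos p₀).ne']

end Model

/-! ### The sup distance of log-ratios and the distance to a face -/

section Distance

variable {E : Type} [Fintype E] [DecidableEq E]

/-- A coordinate difference of log-ratios is the logarithm of a quotient of two ratios of pair sums,
each of which lies between `m` and `M`. With `le_dist_logRatios`, the distance is the log of the
largest ratio over the smallest. -/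
lemma dist_logRatios_le {a b : E → ℝ} (ha : IsAdmissible a) (hb : IsAdmissible b) {m M : ℝ}
    (hm : 0 < m) (hmM : m ≤ M) (h1 : ∀ p, m * pairSum a p ≤ pairSum b p)
    (h2 : ∀ p, pairSum b p ≤ M * pairSum a p) :
    dist (logRatios a) (logRatios b) ≤ Real.log (M / m) := by
  have hM := hm.trans_le hmM
  refine (dist_pi_le_iff (Real.log_nonneg ((one_le_div hm).2 hmM))).2 fun q => ?_
  have lo : ∀ p, Real.log m + Real.log (pairSum a p) ≤ Real.log (pairSum b p) := fun p => by
    rw [← Real.log_mul hm.ne' (ha.pairSum_pos p).ne']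
    exact Real.log_le_log (mul_pos hm (ha.pairSum_pos p)) (h1 p)
  have hi : ∀ p, Real.log (pairSum b p) ≤ Real.log M + Real.log (pairSum a p) := fun p => by
    rw [← Real.log_mul hM.ne' (ha.pairSum_pos p).ne']
    exact Real.log_le_log (hb.pairSum_pos p) (h2 p)
  rw [Real.dist_eq, Real.log_div hM.ne' hm.ne', abs_le]
  simp only [logRatios]
  have := lo q.1; have := lo q.2; have := hi q.1; have := hi q.2
  constructor <;> linarith

lemma le_dist_logRatios {a b : E → ℝ} (ha : IsAdmissible a) (hb : IsAdmissible b)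
    (p q : OffDiag E) :
    Real.log ((pairSum b p / pairSum a p) * (pairSum a q / pairSum b q)) ≤
      dist (logRatios a) (logRatios b) := by
  have h1 := ha.pairSum_pos
  have h2 := hb.pairSum_pos
  rw [Real.log_mul (div_pos (h2 _) (h1 _)).ne' (div_pos (h1 _) (h2 _)).ne',
    Real.log_div (h2 _).ne' (h1 _).ne', Real.log_div (h1 _).ne' (h2 _).ne']
  refine le_trans ?_ (dist_le_pi_dist _ _ (p, q))
  rw [Real.dist_eq, abs_sub_comm]
  refine le_trans (le_of_eq ?_) (le_abs_self _)
  simp only [logRatios]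
  ring

/-- The distance to the vectors vanishing at `e`. -/
lemma infDist_logRatios (hE : 3 ≤ Nat.card E) {a : E → ℝ} (ha : IsAdmissible a) (e : E) :
    Metric.infDist (logRatios a) (logRatios '' {b : E → ℝ | IsAdmissible b ∧ b e = 0}) =
      Real.log (1 + 2 * (a e / minAway a e)) := by
  have hmin := minAway_pos hE ha e
  have hae := ha.nonneg e
  -- A nearest point: the length of `e` is shifted onto all other edges. Pair sums involving `e` are
  -- unchanged, and the others grow by 2 a_e, hence by a factor of at most 1 + 2 a_e / m_e.
  let b₀ : E → ℝ := fun j => if j = e then 0 else a e + a j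
  have hb₀ : IsAdmissible b₀ := by
    refine ⟨fun i => ?_, fun i j hij => ?_⟩
    · by_cases hi : i = e
      · simp [b₀, hi]
      · simp only [b₀, hi, if_false]; exact add_nonneg hae (ha.nonneg i)
    · have hi' := ha.add_pos e i
      have hj' := ha.add_pos e j
      by_cases hi : i = e <;> by_cases hj : j = e
      · exact absurd (hi.trans hj.symm) hij
      · simpa [b₀, hi, hj] using hj' (Ne.symm hj)
      · simpa [b₀, hi, hj] using hi' (Ne.symm hi)
      · simpa [b₀, hi, hj] using add_pos (hi' (Ne.symm hi)) (hj' (Ne.symm hj))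
  have hmem : logRatios b₀ ∈ logRatios '' {b : E → ℝ | IsAdmissible b ∧ b e = 0} :=
    ⟨b₀, ⟨hb₀, by simp [b₀]⟩, rfl⟩
  apply le_antisymm
  · refine (Metric.infDist_le_dist_of_mem hmem).trans ?_
    have hr : 0 ≤ a e / minAway a e := div_nonneg hae hmin.le
    have := dist_logRatios_le ha hb₀ one_pos (M := 1 + 2 * (a e / minAway a e)) (by linarith)
      ?_ ?_
    · simpa using this
    · rintro ⟨⟨i, j⟩, hij⟩
      simp only [pairSum, b₀]
      have hij' : i ≠ j := hij
      split_ifs with hi hj hj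
      · exact absurd (hi.trans hj.symm) hij'
      · rw [hi]; linarith
      · rw [hj]; linarith
      · linarith
    · rintro ⟨⟨i, j⟩, hij⟩
      have hij' : i ≠ j := hij
      have hpos := ha.add_pos i j hij'
      have hmul := mul_nonneg hr hpos.le
      simp only [pairSum, b₀]
      split_ifs with hi hj hj
      · exact absurd (hi.trans hj.symm) hij'
      · rw [hi] at hmul ⊢; linarith
      · rw [hj] at hmul ⊢; linarith
      · have h1 := minAway_le a e hi hj hij'
        have h2 : a e ≤ a e / minAway a e * (a i + a j) := by
          rw [div_mul_eq_mul_div, le_div_iff₀ hmin]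
          exact mul_le_mul_of_nonneg_left h1 hae
        linarith
  · refine (Metric.le_infDist ⟨_, hmem⟩).2 ?_
    rintro _ ⟨b, ⟨hb, hb0⟩, rfl⟩
    obtain ⟨j, k, hj, hk, hjk, hjk'⟩ := exists_minAway_eq hE a e
    -- The lower bound compares the minimal pair (j, k) with a pair (e, l), where l is j or k. The
    -- hypothesis on `l` is what the product of the two ratios needs to reach the bound.
    have main : ∀ l, l ≠ e →
        b l * (2 * a e + a j + a k) ≤ (b j + b k) * (a e + a l) →
        Real.log (1 + 2 * (a e / minAway a e)) ≤ dist (logRatios a) (logRatios b) := by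
      intro l hl hle
      refine le_trans ?_ (le_dist_logRatios ha hb ⟨(j, k), hjk⟩ ⟨(e, l), hl.symm⟩)
      refine Real.log_le_log (by positivity) ?_
      have hbl : 0 < b l := by have := hb.add_pos e l hl.symm; linarith
      simp only [pairSum, hb0, zero_add]
      rw [← hjk'] at hmin ⊢
      rw [div_mul_div_comm, le_div_iff₀ (by positivity)]
      field_simp
      linarith
    -- Adding the inequalities for l = j and l = k gives an equality, so at least one of them holds.
    rcases le_total (b j * (2 * a e + a j + a k)) ((b j + b k) * (a e + a j)) with h | h
    · exact main j hj h
    · refine main k hk ?_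
      nlinarith
end Distance

/-! ## Isometries of complete spaces modelled on admissible vectors -/

/-- An isometric bijection of a dense subset of a complete space extends to the space. -/
lemma exists_isometryEquiv_extending {D M : Type*} [MetricSpace M] [CompleteSpace M] {ι : D → M}
    (hι : DenseRange ι) (Φ : D ≃ D)
    (h : ∀ x y, dist (ι (Φ x)) (ι (Φ y)) = dist (ι x) (ι y)) :
    ∃ Ψ : M ≃ᵢ M, ∀ x, Ψ (ι x) = ι (Φ x) := by
  let _ : PseudoMetricSpace D := PseudoMetricSpace.induced ι inferInstance
  have hiso : Isometry ι := Isometry.of_dist_eq fun _ _ => rfl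
  have hu : IsUniformInducing ι := hiso.isUniformInducing
  have ext : ∀ Θ : D ≃ D, (∀ x y, dist (ι (Θ x)) (ι (Θ y)) = dist (ι x) (ι y)) →
      ∃ f : M → M, Isometry f ∧ ∀ x, f (ι x) = ι (Θ x) := by
    intro Θ hΘ
    have hf : Isometry (ι ∘ Θ) := Isometry.of_dist_eq hΘ
    have hext := uniformContinuous_uniformly_extend hu hι hf.uniformContinuous
    have heq := fun x => uniformly_extend_of_ind hu hι hf.uniformContinuous x
    refine ⟨_, Isometry.of_dist_eq fun x y => ?_, heq⟩
    refine hι.induction_on₂ (p := fun x y => dist ((hu.isDenseInducing hι).extend (ι ∘ Θ) x)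
      ((hu.isDenseInducing hι).extend (ι ∘ Θ) y) = dist x y)
      (isClosed_eq ?_ continuous_dist) (fun x y => ?_) x y
    · exact (hext.continuous.comp continuous_fst).dist (hext.continuous.comp continuous_snd)
    · rw [heq, heq]; exact hΘ x y
  obtain ⟨f, hf, hfe⟩ := ext Φ h
  obtain ⟨g, hg, hge⟩ := ext Φ.symm fun x y => by
    rw [← h, Φ.apply_symm_apply, Φ.apply_symm_apply]
  have hfg : ∀ x, f (g x) = x := fun x => congrFun (hι.equalizer (hf.continuous.comp hg.continuous)
    continuous_id (funext fun x => by simp [hfe, hge])) x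
  exact ⟨IsometryEquiv.mk' f g hfg hf, hfe⟩

/-! ### Faces and isometries in log-ratio coordinates -/

section

variable {E : Type} {M : Type*}

/-- The points of a space with coordinates `τ` whose vector vanishes at `e`. -/
def vanishingFace (τ : M → OffDiag E × OffDiag E → ℝ) (e : E) : Set M :=
  τ ⁻¹' (logRatios '' {a : E → ℝ | IsAdmissible a ∧ a e = 0})

/-- The points of a space with coordinates `τ` whose vector is positive. -/
def positivePart (τ : M → OffDiag E × OffDiag E → ℝ) : Set M :=
  τ ⁻¹' (logRatios '' {a : E → ℝ | ∀ i, 0 < a i})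

variable {τ : M → OffDiag E × OffDiag E → ℝ}

section

variable (hr : Set.range τ = logRatios '' {a : E → ℝ | IsAdmissible a})
include hr

lemma image_vanishingFace (e : E) :
    τ '' vanishingFace τ e = logRatios '' {a : E → ℝ | IsAdmissible a ∧ a e = 0} :=
  Set.image_preimage_eq_of_subset (by rw [hr]; exact Set.image_mono fun a ha => ha.1)

lemma nonempty_vanishingFace (e : E) : (vanishingFace τ e).Nonempty := by
  classical
  rw [← Set.image_nonempty (f := τ), image_vanishingFace hr]
  refine ⟨_, fun i => if i = e then 0 else 1, ⟨⟨fun i => ?_, fun i j hij => ?_⟩, by simp⟩, rfl⟩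
  · split_ifs <;> norm_num
  · by_cases hi : i = e
    · have hj : j ≠ e := fun hj => hij (hi.trans hj.symm)
      simp [hi, hj]
    · simp only [hi, if_false]; split_ifs <;> norm_num

end

section

variable [Finite E] (hE : 3 ≤ Nat.card E)
include hE

/-- Vectors with the same log-ratios are proportional, so vanishing at `e` does not depend on the
vector chosen for `x`. -/
lemma mem_vanishingFace_iff {x : M} {a : E → ℝ} (ha : IsAdmissible a) (hx : τ x = logRatios a)
    (e : E) : x ∈ vanishingFace τ e ↔ a e = 0 := by
  refine ⟨?_, fun h => ⟨a, ⟨ha, h⟩, hx.symm⟩⟩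
  rintro ⟨b, ⟨hb, hb0⟩, h⟩
  obtain ⟨c, -, rfl⟩ := exists_smul_of_logRatios_eq hE hb ha (h.trans hx)
  simp [hb0]

lemma mem_positivePart_iff {x : M} {a : E → ℝ} (ha : IsAdmissible a) (hx : τ x = logRatios a) :
    x ∈ positivePart τ ↔ ∀ e, x ∉ vanishingFace τ e := by
  simp only [mem_vanishingFace_iff hE ha hx]
  refine ⟨?_, fun h => ⟨a, fun i => (ha.nonneg i).lt_of_ne (Ne.symm (h i)), hx.symm⟩⟩
  rintro ⟨b, hb, h⟩ e
  obtain ⟨c, hc, rfl⟩ := exists_smul_of_logRatios_eq hE (isAdmissible_of_pos hb) ha (h.trans hx)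
  exact (mul_pos hc (hb e)).ne'

lemma eq_of_mem_vanishingFace
    (hr : Set.range τ = logRatios '' {a : E → ℝ | IsAdmissible a}) {x : M} {e k : E}
    (h : x ∈ vanishingFace τ e) (h' : x ∈ vanishingFace τ k) : e = k := by
  obtain ⟨a, ha, hx⟩ : τ x ∈ logRatios '' {a : E → ℝ | IsAdmissible a} := hr ▸ ⟨x, rfl⟩
  rw [mem_vanishingFace_iff hE ha hx.symm] at h h'
  by_contra hne
  have := ha.add_pos e k hne
  linarith

end

variable [Fintype E] [DecidableEq E] (hE : 3 ≤ Nat.card E)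
  [MetricSpace M] (hτ : Isometry τ)
  (hr : Set.range τ = logRatios '' {a : E → ℝ | IsAdmissible a})

include hE hτ hr

/-- The coordinates are an isometry onto a closed subset of a complete space. -/
lemma completeSpace_of_range_eq : CompleteSpace M := by
  rw [completeSpace_iff_isComplete_range hτ.isUniformInducing, hr]
  exact (isClosed_image_logRatios hE).isComplete

omit hE in
lemma dense_positivePart : Dense (positivePart τ) := by
  intro x
  obtain ⟨a, ha, hx⟩ : τ x ∈ logRatios '' {a : E → ℝ | IsAdmissible a} := hr ▸ ⟨x, rfl⟩
  rw [hτ.isEmbedding.isInducing.closure_eq_preimage_closure_image, Set.mem_preimage, ← hx,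
    positivePart, Set.image_preimage_eq_of_subset]
  · exact logRatios_mem_closure ha
  · rw [hr]; exact Set.image_mono fun a ha => isAdmissible_of_pos ha

lemma infDist_vanishingFace {x : M} {a : E → ℝ} (ha : IsAdmissible a) (hx : τ x = logRatios a)
    (e : E) : Metric.infDist x (vanishingFace τ e) = Real.log (1 + 2 * (a e / minAway a e)) := by
  rw [← infDist_logRatios hE ha, ← image_vanishingFace hr, ← hx, Metric.infDist_image hτ]

/-- The distances to the faces separate the points. -/
lemma eq_of_infDist_eq {x y : M}
    (h : ∀ e, Metric.infDist x (vanishingFace τ e) = Metric.infDist y (vanishingFace τ e)) :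
    x = y := by
  obtain ⟨a, ha, hx⟩ : τ x ∈ logRatios '' {a : E → ℝ | IsAdmissible a} := hr ▸ ⟨x, rfl⟩
  obtain ⟨b, hb, hy⟩ : τ y ∈ logRatios '' {a : E → ℝ | IsAdmissible a} := hr ▸ ⟨y, rfl⟩
  obtain ⟨c, hc, rfl⟩ := exists_smul_of_div_minAway_eq hE ha hb fun e => by
    have h1 := h e
    rw [infDist_vanishingFace hE hτ hr ha hx.symm, infDist_vanishingFace hE hτ hr hb hy.symm] at h1
    have h2 := div_nonneg (ha.nonneg e) (minAway_pos hE ha e).le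
    have h3 := div_nonneg (hb.nonneg e) (minAway_pos hE hb e).le
    have := Real.log_injOn_pos (show (0 : ℝ) < _ by linarith) (show (0 : ℝ) < _ by linarith) h1
    linarith
  exact hτ.injective (by rw [← hx, ← hy, logRatios_smul hc ha])

/-- By the distance formula the face is exactly the zero set of the distance to it. -/
lemma isClosed_vanishingFace (e : E) : IsClosed (vanishingFace τ e) := by
  have : vanishingFace τ e = {x | Metric.infDist x (vanishingFace τ e) = 0} := by
    ext x
    obtain ⟨a, ha, hx⟩ : τ x ∈ logRatios '' {a : E → ℝ | IsAdmissible a} := hr ▸ ⟨x, rfl⟩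
    have hmin := minAway_pos hE ha e
    have h2 := div_nonneg (ha.nonneg e) hmin.le
    rw [mem_vanishingFace_iff hE ha hx.symm, Set.mem_ofPred_eq,
      infDist_vanishingFace hE hτ hr ha hx.symm]
    constructor
    · intro h; simp [h]
    · intro h
      by_contra hne
      have h3 := div_pos ((ha.nonneg e).lt_of_ne (Ne.symm hne)) hmin
      exact (Real.log_pos (show 1 < 1 + 2 * (a e / minAway a e) by linarith)).ne' h
  rw [this]
  exact isClosed_eq (Metric.continuous_infDist_pt _) continuous_const

/-- An isometry preserving the positive part maps each face into a face. -/
lemma exists_mapsTo_vanishingFace (Ψ : M ≃ᵢ M)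
    (hΨ : ∀ x, Ψ x ∈ positivePart τ ↔ x ∈ positivePart τ) (e : E) :
    ∃ k, Set.MapsTo Ψ (vanishingFace τ e) (vanishingFace τ k) := by
  have bd : ∀ x, x ∉ positivePart τ ↔ ∃ e, x ∈ vanishingFace τ e := fun x => by
    obtain ⟨a, ha, hx⟩ : τ x ∈ logRatios '' {a : E → ℝ | IsAdmissible a} := hr ▸ ⟨x, rfl⟩
    rw [mem_positivePart_iff hE ha hx.symm]
    push Not; rfl
  have hface : ∀ x ∈ vanishingFace τ e, ∃ k, Ψ x ∈ vanishingFace τ k := fun x hx => by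
    rw [← bd, hΨ, bd]; exact ⟨e, hx⟩
  obtain ⟨x₀, hx₀⟩ := nonempty_vanishingFace hr e
  obtain ⟨k, hk⟩ := hface x₀ hx₀
  refine ⟨k, ?_⟩
  -- The image is connected and covered by finitely many disjoint closed faces, so it lies in the
  -- one that it meets.
  have hpre : IsPreconnected (Ψ '' vanishingFace τ e) := by
    refine IsPreconnected.image ?_ _ Ψ.continuous.continuousOn
    rw [← hτ.isEmbedding.isInducing.isPreconnected_image, image_vanishingFace hr]
    exact isPreconnected_image_logRatios e
  have hcl : ∀ k, IsClosed (vanishingFace τ k) := isClosed_vanishingFace hE hτ hr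
  have hsub : Ψ '' vanishingFace τ e ⊆
      vanishingFace τ k ∪ ⋃ l ∈ {l | l ≠ k}, vanishingFace τ l := by
    rintro _ ⟨x, hx, rfl⟩
    obtain ⟨l, hl⟩ := hface x hx
    by_cases hlk : l = k
    · exact Or.inl (hlk ▸ hl)
    · exact Or.inr (Set.mem_iUnion₂.2 ⟨l, hlk, hl⟩)
  have hdisj : Ψ '' vanishingFace τ e ∩
      (vanishingFace τ k ∩ ⋃ l ∈ {l | l ≠ k}, vanishingFace τ l) = ∅ := by
    refine Set.eq_empty_of_forall_notMem ?_
    rintro y ⟨-, h1, h2⟩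
    obtain ⟨l, hl, hl'⟩ := Set.mem_iUnion₂.1 h2
    exact hl (eq_of_mem_vanishingFace hE hr hl' h1)
  rcases isPreconnected_iff_subset_of_disjoint_closed.1 hpre _ _ (hcl k)
    ((Set.toFinite _).isClosed_biUnion fun l _ => hcl l) hsub hdisj with h | h
  · exact fun x hx => h ⟨x, hx, rfl⟩
  · obtain ⟨l, hl, hl'⟩ := Set.mem_iUnion₂.1 (h ⟨x₀, hx₀, rfl⟩)
    exact absurd (eq_of_mem_vanishingFace hE hr hl' hk) hl

/-- An isometry preserving the positive part permutes the faces. -/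
lemma exists_image_vanishingFace (Ψ : M ≃ᵢ M)
    (hΨ : ∀ x, Ψ x ∈ positivePart τ ↔ x ∈ positivePart τ) (e : E) :
    ∃ k, Ψ '' vanishingFace τ e = vanishingFace τ k := by
  have hΨ' : ∀ x, Ψ.symm x ∈ positivePart τ ↔ x ∈ positivePart τ := fun x => by
    rw [← hΨ, Ψ.apply_symm_apply]
  obtain ⟨k, hk⟩ := exists_mapsTo_vanishingFace hE hτ hr Ψ hΨ e
  obtain ⟨l, hl⟩ := exists_mapsTo_vanishingFace hE hτ hr Ψ.symm hΨ' k
  obtain ⟨x, hx⟩ := nonempty_vanishingFace hr e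
  have h1 := hl (hk hx)
  rw [Ψ.symm_apply_apply] at h1
  obtain rfl := eq_of_mem_vanishingFace hE hr h1 hx
  refine ⟨k, Set.Subset.antisymm hk.image_subset fun y hy => ?_⟩
  exact ⟨Ψ.symm y, hl hy, Ψ.apply_symm_apply y⟩

/-- An isometry preserving the positive part fixes the point with equal coordinates. -/
lemma apply_eq_of_logRatios_const (Ψ : M ≃ᵢ M)
    (hΨ : ∀ x, Ψ x ∈ positivePart τ ↔ x ∈ positivePart τ) {x : M}
    (hx : τ x = logRatios fun _ => 1) : Ψ x = x := by
  have hone : IsAdmissible fun _ : E => (1 : ℝ) := isAdmissible_of_pos fun _ => one_pos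
  have hmin : ∀ e : E, minAway (fun _ => (1 : ℝ)) e = 2 := fun e => by
    obtain ⟨j, k, -, -, -, h⟩ := exists_minAway_eq hE (fun _ => (1 : ℝ)) e
    rw [← h]; norm_num
  have hΨ' : ∀ x, Ψ.symm x ∈ positivePart τ ↔ x ∈ positivePart τ := fun x => by
    rw [← hΨ, Ψ.apply_symm_apply]
  refine eq_of_infDist_eq hE hτ hr fun e => ?_
  -- The distance from the image point to the face of `e` is the distance from `x` to some face of
  -- `k`; at equal coordinates all of these are log(1 + 2 · (1/2)).
  obtain ⟨k, hk⟩ := exists_image_vanishingFace hE hτ hr Ψ.symm hΨ' e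
  rw [← Metric.infDist_image Ψ.symm.isometry, Ψ.symm_apply_apply, hk,
    infDist_vanishingFace hE hτ hr hone hx, infDist_vanishingFace hE hτ hr hone hx, hmin, hmin]

/-- An isometry preserving the positive part and every face is the identity. -/
lemma apply_eq_of_mapsTo_vanishingFace (Ψ : M ≃ᵢ M)
    (hΨ : ∀ x, Ψ x ∈ positivePart τ ↔ x ∈ positivePart τ)
    (hface : ∀ e, Set.MapsTo Ψ (vanishingFace τ e) (vanishingFace τ e)) (x : M) : Ψ x = x := by
  refine eq_of_infDist_eq hE hτ hr fun e => ?_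
  obtain ⟨k, hk⟩ := exists_image_vanishingFace hE hτ hr Ψ hΨ e
  obtain ⟨y, hy⟩ := nonempty_vanishingFace hr e
  have hy' : Ψ y ∈ vanishingFace τ k := hk ▸ Set.mem_image_of_mem Ψ hy
  obtain rfl := eq_of_mem_vanishingFace hE hr hy' (hface e hy)
  conv_lhs => rw [← hk]
  exact Metric.infDist_image Ψ.isometry

end

/-! ## Occurrences of edges in homotopy classes of paths -/

namespace FinGraph

/-- The exponent sum of a free generator, as a homomorphism. -/
noncomputable def exponentHom {E : Type} (k : E) : FreeGroup E →* Multiplicative ℤ :=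
  open Classical in FreeGroup.lift fun e => if e = k then Multiplicative.ofAdd 1 else 1

lemma exponentHom_conj {E : Type} (k : E) (r g : FreeGroup E) :
    exponentHom k (r * g * r⁻¹) = exponentHom k g := by
  rw [map_mul, map_mul, map_inv, mul_inv_cancel_comm]

lemma exponentHom_mk_eq_one {E : Type} {k : E} {p : List (E × Bool)} (h : ∀ d ∈ p, d.1 ≠ k) :
    exponentHom k (FreeGroup.mk p) = 1 := by
  rw [exponentHom, FreeGroup.lift_mk]
  refine List.prod_eq_one fun x hx => ?_
  obtain ⟨d, hd, rfl⟩ := List.mem_map.1 hx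
  simp [h d hd]

lemma exponentHom_mk_singleton_ne_one {E : Type} (k : E) (b : Bool) :
    exponentHom k (FreeGroup.mk [(k, b)]) ≠ 1 := by
  rw [exponentHom, FreeGroup.lift_mk]
  cases b <;> simp

/-- An edge whose exponent sum is non-trivial occurs in every path of the conjugacy class. -/
lemma exists_mem_of_exponentHom_ne_one {E : Type} {k : E} {g r : FreeGroup E}
    {p : List (E × Bool)} (h : g = r * FreeGroup.mk p * r⁻¹) (hg : exponentHom k g ≠ 1) :
    ∃ d ∈ p, d.1 = k := by
  by_contra! hcon
  exact hg (by rw [h, exponentHom_conj, exponentHom_mk_eq_one hcon])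

variable (X : FinGraph) {len : X.E → ℝ}

lemma pathLength_cons (d : X.Dart) (p : List X.Dart) :
    X.pathLength len (d :: p) = len d.1 + X.pathLength len p := by
  simp [pathLength]

lemma pathLength_append (p q : List X.Dart) :
    X.pathLength len (p ++ q) = X.pathLength len p + X.pathLength len q := by
  simp [pathLength]

lemma pathLength_nonneg (h : ∀ e, 0 ≤ len e) (p : List X.Dart) : 0 ≤ X.pathLength len p :=
  List.sum_nonneg fun x hx => by
    obtain ⟨d, -, rfl⟩ := List.mem_map.1 hx
    exact h _

lemma le_pathLength (h : ∀ e, 0 ≤ len e) {p : List X.Dart} {k : X.E} (hk : ∃ d ∈ p, d.1 = k) :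
    len k ≤ X.pathLength len p := by
  induction p with
  | nil => simp at hk
  | cons d p ih =>
    rw [pathLength_cons]
    obtain ⟨d', hd', rfl⟩ := hk
    rcases List.mem_cons.1 hd' with rfl | hd'
    · linarith [X.pathLength_nonneg h p]
    · linarith [ih ⟨d', hd', rfl⟩, h d.1]

lemma add_le_pathLength (h : ∀ e, 0 ≤ len e) {p : List X.Dart} {j k : X.E} (hjk : j ≠ k)
    (hj : ∃ d ∈ p, d.1 = j) (hk : ∃ d ∈ p, d.1 = k) : len j + len k ≤ X.pathLength len p := by
  induction p with
  | nil => simp at hk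
  | cons d p ih =>
    rw [pathLength_cons]
    obtain ⟨dj, hdj, rfl⟩ := hj
    obtain ⟨dk, hdk, rfl⟩ := hk
    rcases List.mem_cons.1 hdj with rfl | hj <;> rcases List.mem_cons.1 hdk with rfl | hk
    · exact absurd rfl hjk
    · linarith [X.le_pathLength h ⟨dk, hk, rfl⟩]
    · linarith [X.le_pathLength h ⟨dj, hj, rfl⟩]
    · linarith [ih ⟨dj, hj, rfl⟩ ⟨dk, hk, rfl⟩, h d.1]

end FinGraph

/-! ## Loops in multi-theta graphs -/

namespace MarkedGraph

open FinGraph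

variable {n : ℕ} (X : MarkedGraph n)

/-- The edge `e`, oriented away from the base vertex of a multi-theta graph. -/
noncomputable def outDart (e : X.E) : X.Dart :=
  open Classical in if X.src e = X.base then (e, true) else (e, false)

lemma outDart_fst (e : X.E) : (X.outDart e).1 = e := by
  unfold outDart; split_ifs <;> rfl

/-- The class of the loop which runs along `i` and back along `j`. -/
noncomputable def pairElt (i j : X.E) : FreeGroup X.E :=
  FreeGroup.mk [X.outDart i] * (FreeGroup.mk [X.outDart j])⁻¹

lemma pairElt_inv (i j : X.E) : (X.pairElt i j)⁻¹ = X.pairElt j i := by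
  simp only [pairElt, mul_inv_rev, inv_inv]

lemma pairElt_self (i : X.E) : X.pairElt i i = 1 := mul_inv_cancel _

lemma pairElt_eq_mk (i j : X.E) :
    X.pairElt i j = FreeGroup.mk [X.outDart i, X.rev (X.outDart j)] := by
  simp [pairElt, FreeGroup.invRev, FinGraph.rev]

lemma exponentHom_pairElt_left {i j : X.E} (h : i ≠ j) : exponentHom i (X.pairElt i j) ≠ 1 := by
  have h1 := exponentHom_mk_singleton_ne_one i (X.outDart i).2
  have h2 : X.outDart i = (i, (X.outDart i).2) := Prod.ext (X.outDart_fst i) rfl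
  rw [← h2] at h1
  rwa [pairElt, map_mul, map_inv, exponentHom_mk_eq_one (p := [X.outDart j]), inv_one, mul_one]
  simpa [outDart_fst] using h.symm

lemma exponentHom_pairElt_right {i j : X.E} (h : i ≠ j) : exponentHom j (X.pairElt i j) ≠ 1 := by
  rw [← pairElt_inv, map_inv, ne_eq, inv_eq_one]
  exact X.exponentHom_pairElt_left h.symm

lemma pairElt_ne_one {i j : X.E} (h : i ≠ j) : X.pairElt i j ≠ 1 := fun h1 =>
  X.exponentHom_pairElt_left h (by rw [h1, map_one])

/-- The product of the classes of the loops given by pairs of edges. -/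
noncomputable def pairProd (L : List (OffDiag X.E)) : FreeGroup X.E :=
  (L.map fun p => X.pairElt p.1.1 p.1.2).prod

/-- The loop which runs through the loops given by pairs of edges. -/
noncomputable def pairPath (L : List (OffDiag X.E)) : List X.Dart :=
  L.flatMap fun p => [X.outDart p.1.1, X.rev (X.outDart p.1.2)]

lemma mk_pairPath (L : List (OffDiag X.E)) : FreeGroup.mk (X.pairPath L) = X.pairProd L := by
  induction L with
  | nil => rfl
  | cons p L ih =>
    rw [pairPath, List.flatMap_cons, ← FreeGroup.mul_mk, ← pairElt_eq_mk]
    rw [pairPath] at ih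
    rw [ih, pairProd, pairProd, List.map_cons, List.prod_cons]

lemma pathLength_pairPath (len : X.E → ℝ) (L : List (OffDiag X.E)) :
    X.pathLength len (X.pairPath L) = (L.map (pairSum len)).sum := by
  induction L with
  | nil => rfl
  | cons p L ih =>
    rw [pairPath, List.flatMap_cons, pathLength_append, List.map_cons, List.sum_cons, ← ih]
    simp [pathLength, outDart_fst, pairSum, FinGraph.rev, pairPath]

/-- The pairs in `L` give a loop in the free homotopy class of `w`. -/
def HasClass (w : FreeGroup (Fin n)) (L : List (OffDiag X.E)) : Prop :=
  ∃ h ∈ X.pi1 X.base, (X.marking w : FreeGroup X.E) = h * X.pairProd L * h⁻¹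

namespace IsMultiTheta

variable {X} (hX : X.IsMultiTheta)
include hX

lemma eq_of_ne {u v w : X.V} (hu : u ≠ v) (hw : w ≠ v) : u = w := by
  obtain ⟨x, y, hxy, h⟩ := Nat.card_eq_two_iff.1 hX.1
  have key : ∀ z : X.V, z = x ∨ z = y := fun z => by
    have : z ∈ ({x, y} : Set X.V) := h ▸ Set.mem_univ z
    simpa using this
  rcases key u with rfl | rfl <;> rcases key v with rfl | rfl <;> rcases key w with rfl | rfl <;>
    simp_all

lemma init_ne_term (d : X.Dart) : X.init d ≠ X.term d := by
  obtain ⟨e, b⟩ := d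
  have := hX.2.2 e
  cases b
  · simpa [FinGraph.init, FinGraph.term, FinGraph.rev] using this.symm
  · simpa [FinGraph.init, FinGraph.term, FinGraph.rev] using this

lemma init_outDart (e : X.E) : X.init (X.outDart e) = X.base := by
  unfold outDart
  split_ifs with h
  · simpa [FinGraph.init] using h
  · simpa [FinGraph.init] using hX.eq_of_ne (hX.2.2 e).symm (Ne.symm h)

/-- No edge is a loop, so only one of its two orientations starts at the base vertex. -/
lemma eq_outDart {d : X.Dart} (hd : X.init d = X.base) : d = X.outDart d.1 := by
  have h1 := hX.init_outDart d.1
  have h2 : (X.outDart d.1).1 = d.1 := X.outDart_fst d.1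
  by_contra hne
  have h3 : X.outDart d.1 = X.rev d := by
    refine Prod.ext h2 ?_
    by_contra h
    exact hne (Prod.ext h2.symm (by simpa [FinGraph.rev, eq_comm] using h))
  rw [h3] at h1
  exact hX.init_ne_term d (hd.trans h1.symm)

lemma eq_rev_outDart {d : X.Dart} (hd : X.term d = X.base) : d = X.rev (X.outDart d.1) := by
  have h : X.rev d = X.outDart d.1 := hX.eq_outDart hd
  rw [← h, X.rev_rev]

lemma isPath_pair (i j : X.E) :
    X.IsPath X.base [X.outDart i, X.rev (X.outDart j)] X.base := by
  refine ⟨hX.init_outDart i, ?_, ?_⟩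
  · have h1 := hX.init_ne_term (X.outDart i)
    have h2 := hX.init_ne_term (X.outDart j)
    rw [hX.init_outDart] at h1 h2
    exact hX.eq_of_ne h2.symm h1.symm
  · show X.init (X.rev (X.rev (X.outDart j))) = _
    rw [X.rev_rev, hX.init_outDart]

lemma isPath_pairPath (L : List (OffDiag X.E)) :
    X.IsPath X.base (X.pairPath L) X.base := by
  induction L with
  | nil => rfl
  | cons p L ih => exact X.isPath_append (hX.isPath_pair p.1.1 p.1.2) ih

lemma pairElt_mem_pi1 (i j : X.E) : X.pairElt i j ∈ X.pi1 X.base :=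
  ⟨_, hX.isPath_pair i j, (X.pairElt_eq_mk i j).symm⟩

/-- A loop at the base vertex splits into loops given by pairs of different edges, after removal
of backtrackings. -/
lemma exists_pairProd {len : X.E → ℝ} (hlen : ∀ e, 0 ≤ len e) (p : List X.Dart)
    (hp : X.IsPath X.base p X.base) :
    ∃ L, FreeGroup.mk p = X.pairProd L ∧ (L.map (pairSum len)).sum ≤ X.pathLength len p := by
  match p, hp with
  | [], _ => exact ⟨[], rfl, le_rfl⟩
  | [d], hp => exact absurd (hp.1.trans hp.2.symm) (hX.init_ne_term d)
  | d :: d' :: p, hp =>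
    obtain ⟨h1, h2, h3⟩ := hp
    -- With two vertices and no loop edges, a path is back at its start after two steps.
    have h4 : X.term d' = X.base := by
      refine hX.eq_of_ne (v := X.init d') (hX.init_ne_term d').symm ?_
      rw [h2, ← h1]; exact hX.init_ne_term d
    rw [h4] at h3
    obtain ⟨L, hL, hL'⟩ := exists_pairProd hlen p h3
    have h5 : FreeGroup.mk (d :: d' :: p) = X.pairElt d.1 d'.1 * X.pairProd L := by
      rw [pairElt_eq_mk, ← hX.eq_outDart h1, ← hX.eq_rev_outDart h4, ← hL, FreeGroup.mul_mk]
      rfl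
    rw [pathLength_cons, pathLength_cons]
    -- A step out and back along the same edge is a backtracking: dropping it keeps the class and
    -- does not increase the length.
    by_cases hd : d.1 = d'.1
    · refine ⟨L, by rw [h5, hd, pairElt_self, one_mul], ?_⟩
      linarith [hlen d.1, hlen d'.1]
    · refine ⟨⟨(d.1, d'.1), hd⟩ :: L, h5, ?_⟩
      simp only [List.map_cons, List.sum_cons, pairSum]
      linarith

/-- This makes every pair of edges a competitor in the supremum defining the stretching factor. -/
lemma exists_hasClass (p : OffDiag X.E) : ∃ w, w ≠ 1 ∧ X.HasClass w [p] := by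
  refine ⟨X.marking.symm ⟨_, hX.pairElt_mem_pi1 p.1.1 p.1.2⟩, fun h => ?_, 1, one_mem _, ?_⟩
  · rw [MulEquiv.map_eq_one_iff] at h
    exact X.pairElt_ne_one p.2 (congrArg Subtype.val h)
  · simp [pairProd]

end IsMultiTheta

/-! ## Marked metric graphs represented by edge vectors -/

/-- The lengths of loops of `A` are computed by the edge vector `a` on the edges of the multi-theta
graph `X`. -/
structure Represents (a : X.E → ℝ) (A : MarkedMetricGraph n) : Prop where
  admissible : IsAdmissible a
  exists_hasClass : ∀ w, ∀ l ∈ A.loopLengths w,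
    ∃ L, X.HasClass w L ∧ (L.map (pairSum a)).sum ≤ l
  mem_loopLengths : ∀ w L, X.HasClass w L → (L.map (pairSum a)).sum ∈ A.loopLengths w
  pairSum_le : ∀ w p, X.HasClass w [p] → ∀ l ∈ A.loopLengths w, pairSum a p ≤ l

end MarkedGraph

/-! ### Stretching factors from pair sums -/

namespace MarkedMetricGraph

open MarkedGraph

variable {n : ℕ}

lemma nonneg_of_mem_loopLengths {A : MarkedMetricGraph n} {w : FreeGroup (Fin n)} {l : ℝ}
    (hl : l ∈ A.loopLengths w) : 0 ≤ l := by
  obtain ⟨v, p, r, -, -, -, rfl⟩ := hl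
  exact A.graph.pathLength_nonneg (fun e => (A.len_pos e).le) p

lemma bddBelow_loopLengths (A : MarkedMetricGraph n) (w : FreeGroup (Fin n)) :
    BddBelow (A.loopLengths w) := ⟨0, fun _ => nonneg_of_mem_loopLengths⟩

lemma nonempty_loopLengths (A : MarkedMetricGraph n) (w : FreeGroup (Fin n)) :
    (A.loopLengths w).Nonempty := by
  obtain ⟨p, hp, hp'⟩ := (A.graph.marking w).2
  exact ⟨_, _, p, [], hp, rfl, by rw [← hp', ← FreeGroup.one_eq_mk]; simp, rfl⟩

lemma translationLength_nonneg (A : MarkedMetricGraph n) (w : FreeGroup (Fin n)) :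
    0 ≤ A.translationLength w := Real.sInf_nonneg fun _ => nonneg_of_mem_loopLengths

variable {X : MarkedGraph n} {a b : X.E → ℝ} {A B : MarkedMetricGraph n}

lemma translationLength_of_hasClass (hA : X.Represents a A) {w : FreeGroup (Fin n)}
    {p : OffDiag X.E} (hw : X.HasClass w [p]) : A.translationLength w = pairSum a p := by
  apply le_antisymm
  · exact csInf_le (A.bddBelow_loopLengths w) (by simpa using hA.mem_loopLengths w [p] hw)
  · exact le_csInf (A.nonempty_loopLengths w) (hA.pairSum_le w p hw)

/-- A loop of `A` yields a list of pairs with total at most its length. The same list gives a loop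
of `B` in the same class, and the bound on pair sums is added up over the list. -/
lemma translationLength_le_mul (hA : X.Represents a A) (hB : X.Represents b B) {M : ℝ}
    (hM : 0 ≤ M) (h : ∀ p, pairSum b p ≤ M * pairSum a p) (w : FreeGroup (Fin n)) :
    B.translationLength w ≤ M * A.translationLength w := by
  rw [translationLength, translationLength, ← smul_eq_mul, ← Real.sInf_smul_of_nonneg hM]
  refine le_csInf ((A.nonempty_loopLengths w).smul_set) ?_
  rintro _ ⟨l, hl, rfl⟩
  obtain ⟨L, hL, hL'⟩ := hA.exists_hasClass w l hl
  calc sInf (B.loopLengths w) ≤ (L.map (pairSum b)).sum :=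
        csInf_le (B.bddBelow_loopLengths w) (hB.mem_loopLengths w L hL)
    _ ≤ (L.map fun p => M * pairSum a p).sum := List.sum_le_sum fun p _ => h p
    _ = M * (L.map (pairSum a)).sum := List.sum_map_mul_left _ _ _
    _ ≤ M * l := mul_le_mul_of_nonneg_left hL' hM

/-- The stretching factor is the greatest ratio of pair sums. -/
lemma exists_stretch_eq (hX : X.IsMultiTheta) (hE : 3 ≤ Nat.card X.E) (hA : X.Represents a A)
    (hB : X.Represents b B) :
    (∃ p, stretch A B = pairSum b p / pairSum a p) ∧
      ∀ q, pairSum b q ≤ stretch A B * pairSum a q := by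
  have := X.finE
  have := nonempty_offDiag hE
  obtain ⟨p, hp⟩ := Finite.exists_max fun p => pairSum b p / pairSum a p
  have ha := hA.admissible.pairSum_pos
  have hb := hB.admissible.pairSum_pos
  have hM := (div_pos (hb p) (ha p)).le
  have hle : ∀ q, pairSum b q ≤ pairSum b p / pairSum a p * pairSum a q := fun q => by
    rw [← div_le_iff₀ (ha q)]; exact hp q
  -- This needs no positivity of translation lengths: a quotient with denominator zero is zero.
  have hub : ∀ w, B.translationLength w / A.translationLength w ≤ pairSum b p / pairSum a p :=
    fun w => div_le_of_le_mul₀ (A.translationLength_nonneg w) hM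
      (translationLength_le_mul hA hB hM hle w)
  obtain ⟨w, hw1, hw⟩ := hX.exists_hasClass p
  have hs : stretch A B = pairSum b p / pairSum a p := by
    have : Nonempty {w : FreeGroup (Fin n) // w ≠ 1} := ⟨⟨w, hw1⟩⟩
    refine le_antisymm (ciSup_le fun w => hub w) ?_
    rw [← translationLength_of_hasClass hA hw, ← translationLength_of_hasClass hB hw]
    refine le_ciSup (f := fun w : {w : FreeGroup (Fin n) // w ≠ 1} =>
      B.translationLength w / A.translationLength w) ⟨pairSum b p / pairSum a p, ?_⟩ ⟨w, hw1⟩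
    rintro _ ⟨w, rfl⟩
    exact hub w
  exact ⟨⟨p, hs⟩, fun q => hs ▸ hle q⟩

/-- One stretching factor is the largest ratio of pair sums, and the inverse of the other is the
smallest. -/
lemma lipDist_eq_dist [Fintype X.E] [DecidableEq X.E] (hX : X.IsMultiTheta)
    (hE : 3 ≤ Nat.card X.E) (hA : X.Represents a A) (hB : X.Represents b B) :
    lipDist A B = dist (logRatios a) (logRatios b) := by
  obtain ⟨⟨p, hp⟩, h1⟩ := exists_stretch_eq hX hE hA hB
  obtain ⟨⟨q, hq⟩, h2⟩ := exists_stretch_eq hX hE hB hA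
  have ha := hA.admissible.pairSum_pos
  have hb := hB.admissible.pairSum_pos
  have hpos : 0 < stretch B A := hq ▸ div_pos (ha q) (hb q)
  have h3 : ∀ p, (stretch B A)⁻¹ * pairSum a p ≤ pairSum b p := fun p => by
    rw [inv_mul_le_iff₀ hpos]; exact h2 p
  apply le_antisymm
  · rw [lipDist, mul_comm, hp, hq]
    exact le_dist_logRatios hA.admissible hB.admissible p q
  · have := dist_logRatios_le hA.admissible hB.admissible (inv_pos.2 hpos)
      (le_of_mul_le_mul_right ((h3 p).trans (h1 p)) (ha p)) h3 h1
    rwa [div_inv_eq_mul, mul_comm] at this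

end MarkedMetricGraph

namespace MarkedGraph

open FinGraph

variable {n : ℕ} {X : MarkedGraph n}

/-- A metric on a multi-theta graph is represented by its edge lengths. -/
lemma IsMultiTheta.represents (hX : X.IsMultiTheta) {len : X.E → ℝ} (hlen : ∀ e, 0 < len e) :
    X.Represents len ⟨X, len, hlen⟩ where
  admissible := isAdmissible_of_pos hlen
  exists_hasClass := by
    rintro w l ⟨v, p, r, hp, hr, hw, rfl⟩
    -- A loop based at the other vertex is rotated by moving its first oriented edge to the end,
    -- which changes neither its length nor its free homotopy class.
    suffices H : ∀ p r, X.IsPath X.base p X.base → X.IsPath X.base r X.base →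
        (X.marking w : FreeGroup X.E) = FreeGroup.mk r * FreeGroup.mk p * (FreeGroup.mk r)⁻¹ →
        ∃ L, X.HasClass w L ∧ (L.map (pairSum len)).sum ≤ X.pathLength len p by
      by_cases hv : v = X.base
      · subst hv; exact H p r hp hr hw
      cases p with
      | nil =>
        refine ⟨[], ⟨1, one_mem _, ?_⟩, le_rfl⟩
        rw [hw, ← FreeGroup.one_eq_mk, mul_one, mul_inv_cancel]
        simp [pairProd]
      | cons d p =>
        obtain ⟨rfl, hp⟩ := hp
        have ht : X.term d = X.base :=
          hX.eq_of_ne (v := X.init d) (hX.init_ne_term d).symm (Ne.symm hv)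
        have hd : X.IsPath (X.init d) [d] X.base := ⟨rfl, ht⟩
        rw [ht] at hp
        obtain ⟨L, hL, hL'⟩ := H (p ++ [d]) (r ++ [d]) (X.isPath_append hp hd)
          (X.isPath_append hr hd) (by
            have h1 : FreeGroup.mk (d :: p) = FreeGroup.mk [d] * FreeGroup.mk p := by
              rw [FreeGroup.mul_mk]; rfl
            rw [hw, h1, ← FreeGroup.mul_mk, ← FreeGroup.mul_mk]
            group)
        refine ⟨L, hL, hL'.trans (le_of_eq ?_)⟩
        show X.pathLength len (p ++ [d]) = X.pathLength len (d :: p)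
        simp only [pathLength_append, pathLength_cons]
        simp [pathLength, add_comm]
    intro p r hp hr hw
    obtain ⟨L, hL, hL'⟩ := hX.exists_pairProd (fun e => (hlen e).le) p hp
    exact ⟨L, ⟨_, ⟨r, hr, rfl⟩, by rw [hw, hL]⟩, hL'⟩
  mem_loopLengths := by
    rintro w L ⟨_, ⟨r, hr, rfl⟩, hw⟩
    exact ⟨X.base, X.pairPath L, r, hX.isPath_pairPath L, hr, by rw [X.mk_pairPath]; exact hw,
      (X.pathLength_pairPath len L).symm⟩
  pairSum_le := by
    rintro w ⟨⟨i, j⟩, hij⟩ ⟨h, -, hw⟩ l ⟨v, p, r, -, -, hw', rfl⟩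
    -- Exponent sums are conjugation invariant, and those of `i` and `j` are non-trivial on the pair
    -- loop. So every loop in the class crosses both edges, whence the bound.
    have hconj : X.pairElt i j =
        (h⁻¹ * FreeGroup.mk r) * FreeGroup.mk p * (h⁻¹ * FreeGroup.mk r)⁻¹ := by
      have h1 : (X.marking w : FreeGroup X.E) = h * X.pairElt i j * h⁻¹ := by
        simpa [pairProd] using hw
      have h2 : X.pairElt i j = h⁻¹ * (X.marking w : FreeGroup X.E) * h := by rw [h1]; group
      rw [h2, show (X.marking w : FreeGroup X.E) = _ from hw']
      group
    exact X.add_le_pathLength (fun e => (hlen e).le) hij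
      (exists_mem_of_exponentHom_ne_one hconj (X.exponentHom_pairElt_left hij))
      (exists_mem_of_exponentHom_ne_one hconj (X.exponentHom_pairElt_right hij))

end MarkedGraph

/-! ## The rose-faces of a multi-theta simplex -/

namespace MarkedGraph

open FinGraph

/-- The graph with one vertex whose petals are the edges of `X` different from `e`. -/
def petalGraph (X : FinGraph) (e : X.E) : FinGraph where
  V := Unit
  E := {i : X.E // i ≠ e}
  finV := inferInstance
  finE := have := X.finE; inferInstance
  src _ := ()
  tgt _ := ()

/-- In a graph with one vertex every list of oriented edges is a path. -/
lemma isPath_of_subsingleton (Y : FinGraph) [Subsingleton Y.V] (p : List Y.Dart) (v w : Y.V) :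
    Y.IsPath v p w := by
  induction p generalizing v with
  | nil => exact Subsingleton.elim _ _
  | cons d p ih => exact ⟨Subsingleton.elim _ _, ih _⟩

lemma pi1_eq_top_of_subsingleton (Y : FinGraph) [Subsingleton Y.V] (v : Y.V) : Y.pi1 v = ⊤ :=
  eq_top_iff.2 fun g _ => by
    obtain ⟨p, hp⟩ := Quot.exists_rep g
    exact ⟨p, isPath_of_subsingleton Y p v v, hp⟩

/-- The petal coming from an edge different from `e`. -/
def petal (X : FinGraph) {e i : X.E} (h : i ≠ e) : (petalGraph X e).E := ⟨i, h⟩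

instance (X : FinGraph) (e : X.E) : Subsingleton (petalGraph X e).V :=
  inferInstanceAs (Subsingleton Unit)

variable {n : ℕ} {X : MarkedGraph n}

/-- The homomorphism induced by a collapse on an oriented edge. -/
lemma CollapseMap.hom_mk_singleton {X Y : FinGraph} {S : Set X.E} (κ : CollapseMap X Y S)
    (d : X.Dart) : (d.1 ∈ S → κ.hom (FreeGroup.mk [d]) = 1) ∧
      ∀ h : d.1 ∉ S, κ.hom (FreeGroup.mk [d]) = FreeGroup.mk [κ.onD ⟨d, h⟩] := by
  obtain ⟨e, b⟩ := d
  have h1 : FreeGroup.mk [(e, b)] = cond b (FreeGroup.of e) (FreeGroup.of e)⁻¹ := by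
    cases b <;> rfl
  refine ⟨fun h => ?_, fun h => ?_⟩
  · have h : e ∈ S := h
    rw [h1]
    cases b <;> simp [CollapseMap.hom, h]
  · have h : e ∉ S := h
    rw [h1]
    cases b
    · have h2 : κ.onD ⟨(e, false), h⟩ = Y.rev (κ.onD ⟨(e, true), h⟩) := κ.onD_rev ⟨(e, true), h⟩
      rw [h2]
      simp [CollapseMap.hom, h, FreeGroup.invRev, FinGraph.rev]
    · simp [CollapseMap.hom, h]

namespace IsMultiTheta

variable (hX : X.IsMultiTheta)
include hX

/-- The collapse of the edge `e` of a multi-theta graph. -/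
def petalCollapse (e : X.E) : CollapseMap X.toFinGraph (petalGraph X.toFinGraph e) {e} where
  onV _ := ()
  onD :=
    { toFun := fun d => (⟨d.1.1, d.2⟩, d.1.2)
      invFun := fun d => ⟨(d.1.1, d.2), d.1.2⟩
      left_inv := fun _ => rfl
      right_inv := fun _ => rfl }
  onD_rev _ := rfl
  init_onD _ := rfl
  onV_surjective _ := ⟨X.base, rfl⟩
  onV_eq_iff v w := by
    refine ⟨fun _ => ?_, fun _ => rfl⟩
    by_cases hvw : v = w
    · exact ⟨[], hvw, by simp⟩
    -- The edge `e` alone joins the two vertices, in one orientation or the other.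
    have key : ∀ d : X.Dart, d.1 = e → X.init d = v →
        ∃ p, X.IsPath v p w ∧ ∀ d ∈ p, d.1 ∈ ({e} : Set X.E) := fun d hd hdv =>
      ⟨[d], ⟨hdv, hX.eq_of_ne (hdv ▸ (hX.init_ne_term d).symm) (Ne.symm hvw)⟩, by simpa using hd⟩
    by_cases h : X.init (e, true) = v
    · exact key _ rfl h
    · exact key (e, false) rfl (hX.eq_of_ne (hX.init_ne_term (e, true)).symm (Ne.symm h))

lemma petalCollapse_outDart_self (e : X.E) :
    (hX.petalCollapse e).hom (FreeGroup.mk [X.outDart e]) = 1 :=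
  ((hX.petalCollapse e).hom_mk_singleton _).1 (X.outDart_fst e)

lemma petalCollapse_outDart {e i : X.E} (hi : i ≠ e) :
    (hX.petalCollapse e).hom (FreeGroup.mk [X.outDart i]) =
      FreeGroup.mk [(petal X.toFinGraph hi, (X.outDart i).2)] := by
  have h : (X.outDart i).1 ∉ ({e} : Set X.E) := by rw [X.outDart_fst]; exact hi
  rw [((hX.petalCollapse e).hom_mk_singleton _).2 h]
  have h2 : (hX.petalCollapse e).onD ⟨X.outDart i, h⟩ =
      (petal X.toFinGraph h, (X.outDart i).2) := rfl
  have h3 : petal X.toFinGraph h = petal X.toFinGraph hi := Subtype.ext (X.outDart_fst i)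
  rw [h2, h3]

end IsMultiTheta

variable (X) in
/-- The loop in a multi-theta graph given by a petal of the rose obtained by collapsing `e`. -/
noncomputable def petalLift (e : X.E) : FreeGroup (petalGraph X.toFinGraph e).E →* FreeGroup X.E :=
  FreeGroup.lift fun y => if (X.outDart y.1).2 = true then X.pairElt y.1 e else X.pairElt e y.1

lemma petalLift_mk_out (e : X.E) (y : (petalGraph X.toFinGraph e).E) :
    X.petalLift e (FreeGroup.mk [(y, (X.outDart y.1).2)]) = X.pairElt y.1 e := by
  rw [petalLift, FreeGroup.lift_mk]
  cases h : (X.outDart y.1).2 <;> simp [h, pairElt_inv]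

lemma petalLift_mk_in (e : X.E) (y : (petalGraph X.toFinGraph e).E) :
    X.petalLift e (FreeGroup.mk [(y, !(X.outDart y.1).2)]) = X.pairElt e y.1 := by
  rw [petalLift, FreeGroup.lift_mk]
  cases h : (X.outDart y.1).2 <;> simp [h, pairElt_inv]

/-- A path in the rose lifts to a loop of the same length. -/
lemma exists_petalLift_mk_eq {e : X.E} {a : X.E → ℝ} (ha : a e = 0)
    (p : List (petalGraph X.toFinGraph e).Dart) :
    ∃ L, X.petalLift e (FreeGroup.mk p) = X.pairProd L ∧
      (L.map (pairSum a)).sum = (petalGraph X.toFinGraph e).pathLength (fun y => a y.1) p := by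
  induction p with
  | nil => exact ⟨[], by rw [← FreeGroup.one_eq_mk, map_one]; rfl, rfl⟩
  | cons d p ih =>
    obtain ⟨L, hL, hL'⟩ := ih
    obtain ⟨y, b⟩ := d
    have hye : y.1 ≠ e := y.2
    have h1 : FreeGroup.mk ((y, b) :: p) = FreeGroup.mk [(y, b)] * FreeGroup.mk p := by
      rw [FreeGroup.mul_mk]; rfl
    rw [h1, map_mul, hL, pathLength_cons, ← hL']
    by_cases hb : b = (X.outDart y.1).2
    · refine ⟨⟨(y.1, e), hye⟩ :: L, ?_, ?_⟩
      · rw [hb, petalLift_mk_out]; rfl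
      · simp [pairSum, ha]
    · refine ⟨⟨(e, y.1), hye.symm⟩ :: L, ?_, ?_⟩
      · rw [Bool.eq_not_of_ne hb, petalLift_mk_in]; rfl
      · simp [pairSum, ha]

namespace IsMultiTheta

variable (hX : X.IsMultiTheta)
include hX

lemma petalLift_mem_pi1 (e : X.E) (g : FreeGroup (petalGraph X.toFinGraph e).E) :
    X.petalLift e g ∈ X.pi1 X.base := by
  obtain ⟨q, rfl⟩ : ∃ q, FreeGroup.mk q = g := Quot.exists_rep g
  obtain ⟨L, hL, -⟩ := exists_petalLift_mk_eq (a := fun _ => 0) (e := e) rfl q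
  exact ⟨_, hX.isPath_pairPath L, by rw [X.mk_pairPath, hL]⟩

lemma petalCollapse_pairElt_out {e : X.E} (y : (petalGraph X.toFinGraph e).E) :
    (hX.petalCollapse e).hom (X.pairElt y.1 e) = FreeGroup.mk [(y, (X.outDart y.1).2)] := by
  rw [pairElt, map_mul, map_inv, hX.petalCollapse_outDart_self, hX.petalCollapse_outDart y.2,
    inv_one, mul_one]
  rfl

lemma petalCollapse_petalLift (e : X.E) (g : FreeGroup (petalGraph X.toFinGraph e).E) :
    (hX.petalCollapse e).hom (X.petalLift e g) = g := by
  suffices h : (hX.petalCollapse e).hom.comp (X.petalLift e) = MonoidHom.id _ from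
    DFunLike.congr_fun h g
  ext y
  simp only [MonoidHom.comp_apply, MonoidHom.id_apply, petalLift, FreeGroup.lift_apply_of]
  split_ifs with h
  · rw [hX.petalCollapse_pairElt_out, h]; rfl
  · rw [← pairElt_inv, map_inv, hX.petalCollapse_pairElt_out, Bool.eq_false_of_not_eq_true h]
    simp [FreeGroup.invRev, FreeGroup.of]

/-- The lift completes each petal by a passage along `e`. In out along `i` and back along `j`, the
two inserted passages along `e` cancel. -/
lemma petalLift_petalCollapse_pairElt (e i j : X.E) :
    X.petalLift e ((hX.petalCollapse e).hom (X.pairElt i j)) = X.pairElt i j := by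
  have key : ∀ i, X.petalLift e ((hX.petalCollapse e).hom (FreeGroup.mk [X.outDart i])) =
      X.pairElt i e := fun i => by
    by_cases hi : i = e
    · subst hi; rw [hX.petalCollapse_outDart_self, map_one, pairElt_self]
    · rw [hX.petalCollapse_outDart hi]; exact petalLift_mk_out e ⟨i, hi⟩
  rw [pairElt, map_mul, map_inv, map_mul, map_inv, key, key]
  simp only [pairElt]
  group

lemma petalLift_petalCollapse {e : X.E} {g : FreeGroup X.E} (hg : g ∈ X.pi1 X.base) :
    X.petalLift e ((hX.petalCollapse e).hom g) = g := by
  obtain ⟨p, hp, rfl⟩ := hg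
  obtain ⟨L, hL, -⟩ := hX.exists_pairProd (len := fun _ => 0) (fun _ => le_rfl) p hp
  rw [hL, pairProd, map_list_prod, map_list_prod, List.map_map, List.map_map]
  congr 1
  exact List.map_congr_left fun p _ => hX.petalLift_petalCollapse_pairElt e p.1.1 p.1.2

/-- The collapse of an edge of a multi-theta graph induces an isomorphism of fundamental groups. -/
noncomputable def petalEquiv (e : X.E) :
    X.pi1 X.base ≃* (petalGraph X.toFinGraph e).pi1 (Unit.unit : Unit) where
  toFun g := ⟨(hX.petalCollapse e).hom g, (pi1_eq_top_of_subsingleton (petalGraph X.toFinGraph e) _).ge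
    (Subgroup.mem_top _)⟩
  invFun g := ⟨X.petalLift e g, hX.petalLift_mem_pi1 e g⟩
  left_inv g := Subtype.ext (hX.petalLift_petalCollapse g.2)
  right_inv g := Subtype.ext (hX.petalCollapse_petalLift e g)
  map_mul' g h := Subtype.ext (by simp)

lemma card_petals (e : X.E) : Nat.card {i : X.E // i ≠ e} = n := by
  have := X.finE
  have := Fintype.ofFinite X.E
  classical
  have h := hX.2.1
  rw [Nat.card_eq_fintype_card] at h ⊢
  rw [Fintype.card_subtype_compl, Fintype.card_subtype_eq, h]
  rfl

/-- The marked rose obtained from a multi-theta graph by collapsing the edge `e`. -/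
noncomputable def petalRose (hn : 2 ≤ n) (e : X.E) : MarkedGraph n where
  toFinGraph := petalGraph X.toFinGraph e
  connected _ _ := ⟨[], rfl⟩
  three_le_valence v := by
    have h : Nat.card ({i : X.E // i ≠ e} × Bool) = n * 2 := by
      rw [Nat.card_prod, hX.card_petals]; simp
    have h2 : (petalGraph X.toFinGraph e).valence v = Nat.card ({i : X.E // i ≠ e} × Bool) :=
      Nat.card_congr (Equiv.subtypeUnivEquiv fun _ => rfl)
    omega
  base := ()
  marking := X.marking.trans (hX.petalEquiv e)

variable (hn : 2 ≤ n)

lemma petalRose_marking (e : X.E) (w : FreeGroup (Fin n)) :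
    ((hX.petalRose hn e).marking w : FreeGroup (hX.petalRose hn e).E) =
      (hX.petalCollapse e).hom (X.marking w : FreeGroup X.E) := rfl

lemma isRose_petalRose (e : X.E) : (hX.petalRose hn e).IsRose :=
  ⟨Nat.card_unique (α := Unit), hX.card_petals e⟩

lemma isCollapse_petalRose (e : X.E) : X.IsCollapse (hX.petalRose hn e) {e} :=
  ⟨hX.petalCollapse e, [], rfl, fun w => by
    rw [hX.petalRose_marking, ← FreeGroup.one_eq_mk, inv_one, mul_one, one_mul]
    rfl⟩

lemma isRoseFace_petalRose (e : X.E) : X.IsRoseFace (hX.petalRose hn e).simplex :=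
  ⟨_, hX.isRose_petalRose hn e, ⟨_, hX.isCollapse_petalRose hn e⟩, rfl⟩

lemma mem_loopLengths_petalRose {e : X.E} {a : X.E → ℝ}
    {hpos : ∀ i : (petalGraph X.toFinGraph e).E, 0 < a i.1} {w : FreeGroup (Fin n)} {l : ℝ} :
    l ∈ MarkedMetricGraph.loopLengths ⟨hX.petalRose hn e, fun i => a i.1, hpos⟩ w ↔
      ∃ p r : List (petalGraph X.toFinGraph e).Dart,
        (hX.petalCollapse e).hom (X.marking w : FreeGroup X.E) =
          FreeGroup.mk r * FreeGroup.mk p * (FreeGroup.mk r)⁻¹ ∧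
        l = (petalGraph X.toFinGraph e).pathLength (fun y => a y.1) p := by
  constructor
  · rintro ⟨v, p, r, -, -, hw, hl⟩
    exact ⟨p, r, hw, hl⟩
  · rintro ⟨p, r, hw, hl⟩
    exact ⟨(Unit.unit : Unit), p, r, isPath_of_subsingleton (petalGraph X.toFinGraph e) _ _ _,
      isPath_of_subsingleton (petalGraph X.toFinGraph e) _ _ _, hw, hl⟩

/-- A metric on the rose obtained by collapsing `e` is represented by its edge lengths, with length
zero for `e`. -/
lemma represents_petalRose {e : X.E} {a : X.E → ℝ} (ha : a e = 0)
    (hpos : ∀ i : (petalGraph X.toFinGraph e).E, 0 < a i.1) :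
    X.Represents a ⟨hX.petalRose hn e, fun i => a i.1, hpos⟩ where
  admissible := by
    have hnn : ∀ i, 0 ≤ a i := fun i => by
      by_cases hi : i = e
      · rw [hi, ha]
      · exact (hpos ⟨i, hi⟩).le
    refine ⟨hnn, fun i j hij => ?_⟩
    by_cases hi : i = e
    · exact add_pos_of_nonneg_of_pos (hnn i) (hpos ⟨j, fun hj => hij (hi.trans hj.symm)⟩)
    · exact add_pos_of_pos_of_nonneg (hpos ⟨i, hi⟩) (hnn j)
  exists_hasClass := by
    intro w l hl
    obtain ⟨p, r, hw', rfl⟩ := (hX.mem_loopLengths_petalRose hn).1 hl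
    obtain ⟨L, hL, hL'⟩ := exists_petalLift_mk_eq ha p
    refine ⟨L, ⟨X.petalLift e (FreeGroup.mk r), hX.petalLift_mem_pi1 e _, ?_⟩, hL'.le⟩
    rw [← hX.petalLift_petalCollapse (e := e) (X.marking w).2, hw', map_mul, map_mul, map_inv, hL]
  mem_loopLengths := by
    rintro w L ⟨h, -, hw⟩
    -- The pair loops are pushed to the rose one oriented edge at a time; `e` becomes the empty
    -- path, in accordance with its length zero.
    obtain ⟨q, hq, hq'⟩ : ∃ q, FreeGroup.mk q = (hX.petalCollapse e).hom (X.pairProd L) ∧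
        (L.map (pairSum a)).sum =
          (petalGraph X.toFinGraph e).pathLength (fun y => a y.1) q := by
      clear hw
      have dart : ∀ i, ∃ q, FreeGroup.mk q =
          (hX.petalCollapse e).hom (FreeGroup.mk [X.outDart i]) ∧
          (petalGraph X.toFinGraph e).pathLength (fun y => a y.1) q = a i := fun i => by
        by_cases hi : i = e
        · subst hi
          exact ⟨[], by rw [hX.petalCollapse_outDart_self]; rfl, ha.symm⟩
        · exact ⟨_, (hX.petalCollapse_outDart hi).symm, by simp [pathLength, petal]⟩
      induction L with
      | nil => exact ⟨[], by rw [pairProd, List.map_nil, List.prod_nil, map_one]; rfl, rfl⟩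
      | cons p L ih =>
        obtain ⟨q, hq, hq'⟩ := ih
        obtain ⟨s, hs, hs'⟩ := dart p.1.1
        obtain ⟨t, ht, ht'⟩ := dart p.1.2
        refine ⟨s ++ (FreeGroup.invRev t ++ q), ?_, ?_⟩
        · rw [← FreeGroup.mul_mk, ← FreeGroup.mul_mk, ← FreeGroup.inv_mk, hs, ht, hq, pairProd,
            pairProd, List.map_cons, List.prod_cons, map_mul, pairElt, map_mul, map_inv, mul_assoc]
        · have hinv : (petalGraph X.toFinGraph e).pathLength (fun y => a y.1)
              (FreeGroup.invRev t) = a p.1.2 := by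
            rw [← ht']
            simp [pathLength, FreeGroup.invRev, List.map_reverse, Function.comp_def]
          rw [pathLength_append, pathLength_append, hs', hinv, ← hq', List.map_cons,
            List.sum_cons, pairSum, add_assoc]
    obtain ⟨r, hr⟩ : ∃ r, FreeGroup.mk r = (hX.petalCollapse e).hom h := Quot.exists_rep _
    refine (hX.mem_loopLengths_petalRose hn).2 ⟨q, r, ?_, hq'⟩
    rw [hr, hq, hw, map_mul, map_mul, map_inv]
  pairSum_le := by
    rintro w ⟨⟨i, j⟩, hij⟩ ⟨h, -, hw⟩ l hl
    obtain ⟨p, r, h3, rfl⟩ := (hX.mem_loopLengths_petalRose hn).1 hl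
    have hij : i ≠ j := hij
    have hconj : (hX.petalCollapse e).hom (X.pairElt i j) =
        ((hX.petalCollapse e).hom h⁻¹ * FreeGroup.mk r) * FreeGroup.mk p *
          ((hX.petalCollapse e).hom h⁻¹ * FreeGroup.mk r)⁻¹ := by
      have h1 : (X.marking w : FreeGroup X.E) = h * X.pairElt i j * h⁻¹ := by
        simpa [pairProd] using hw
      have h2 : X.pairElt i j = h⁻¹ * (X.marking w : FreeGroup X.E) * h := by rw [h1]; group
      rw [h2, map_mul, map_mul, h3, map_inv]
      group
    have hnn : ∀ y : (petalGraph X.toFinGraph e).E, 0 ≤ a y.1 := fun y => (hpos y).le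
    -- The petal of `k` is crossed once, and the other edge is either collapsed or a different
    -- petal, so the exponent sum survives the collapse.
    have expo : ∀ (k l : X.E) (hk : k ≠ e), k ≠ l →
        exponentHom (petal X.toFinGraph hk) ((hX.petalCollapse e).hom (X.pairElt k l)) ≠ 1 :=
      fun k l hk hkl => by
        have h1 := exponentHom_mk_singleton_ne_one (petal X.toFinGraph hk) (X.outDart k).2
        rw [pairElt, map_mul, map_inv, map_mul, map_inv, hX.petalCollapse_outDart hk]
        by_cases hl : l = e
        · subst hl
          rwa [hX.petalCollapse_outDart_self, map_one, inv_one, mul_one]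
        · rw [hX.petalCollapse_outDart hl]
          have h2 := exponentHom_mk_eq_one (k := petal X.toFinGraph hk)
            (p := [(petal X.toFinGraph hl, (X.outDart l).2)])
            (fun d hd => by
              rw [List.mem_singleton.1 hd]
              exact fun h => hkl (congrArg Subtype.val h).symm)
          rwa [h2, inv_one, mul_one]
    have occ_left : ∀ hi : i ≠ e, ∃ d ∈ p, d.1 = petal X.toFinGraph hi := fun hi =>
      exists_mem_of_exponentHom_ne_one hconj (expo i j hi hij)
    have occ_right : ∀ hj : j ≠ e, ∃ d ∈ p, d.1 = petal X.toFinGraph hj := fun hj =>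
      exists_mem_of_exponentHom_ne_one hconj (by
        rw [← pairElt_inv, map_inv, map_inv, ne_eq, inv_eq_one]
        exact expo j i hj hij.symm)
    show a i + a j ≤ (petalGraph X.toFinGraph e).pathLength (fun y => a y.1) p
    by_cases hi : i = e
    · have hj : j ≠ e := fun hj => hij (hi.trans hj.symm)
      rw [hi, ha, zero_add]
      exact le_pathLength _ hnn (occ_right hj)
    by_cases hj : j = e
    · rw [hj, ha, add_zero]
      exact le_pathLength _ hnn (occ_left hi)
    · exact add_le_pathLength _ hnn (fun h => hij (congrArg Subtype.val h))
        (occ_left hi) (occ_right hj)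

end IsMultiTheta

end MarkedGraph

/-! ## Coordinates on a multi-theta simplex with its rose-faces -/

namespace MarkedGraph

open FinGraph

variable {n : ℕ} {X : MarkedGraph n}

/-- Two collapses of the same edges onto graphs with one vertex differ by an isomorphism. -/
def CollapseMap.graphIso {X Y Z : FinGraph} [Subsingleton Y.V] [Subsingleton Z.V] {S : Set X.E}
    (κ : CollapseMap X Y S) (κ' : CollapseMap X Z S) (y : Y.V) (z : Z.V) : GraphIso Y Z where
  onV := ⟨fun _ => z, fun _ => y, fun _ => Subsingleton.elim _ _, fun _ => Subsingleton.elim _ _⟩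
  onD := κ.onD.symm.trans κ'.onD
  onD_rev d := by
    obtain ⟨d, rfl⟩ := κ.onD.surjective d
    rw [← κ.onD_rev]
    simp only [Equiv.trans_apply, Equiv.symm_apply_apply]
    exact κ'.onD_rev d
  init_onD _ := Subsingleton.elim _ _

lemma CollapseMap.graphIso_hom {X Y Z : FinGraph} [Subsingleton Y.V] [Subsingleton Z.V]
    {S : Set X.E} (κ : CollapseMap X Y S) (κ' : CollapseMap X Z S) (y : Y.V) (z : Z.V)
    (g : FreeGroup X.E) : (κ.graphIso κ' y z).hom (κ.hom g) = κ'.hom g := by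
  suffices h : (κ.graphIso κ' y z).hom.comp κ.hom = κ'.hom from DFunLike.congr_fun h g
  ext e
  rw [MonoidHom.comp_apply, show FreeGroup.of e = FreeGroup.mk [(e, true)] from rfl]
  by_cases h : e ∈ S
  · rw [(κ.hom_mk_singleton (e, true)).1 h, (κ'.hom_mk_singleton (e, true)).1 h, map_one]
  · rw [(κ.hom_mk_singleton (e, true)).2 h, (κ'.hom_mk_singleton (e, true)).2 h, GraphIso.hom_mk]
    simp [graphIso]

/-- Compatibility with reversal makes the target edge independent of orientation, so edge lengths
can be transported along `κ`. -/
lemma CollapseMap.onD_fst {X Y : FinGraph} {S : Set X.E} (κ : CollapseMap X Y S)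
    (d : {d : X.Dart // d.1 ∉ S}) : (κ.onD d).1 = (κ.onD ⟨(d.1.1, true), d.2⟩).1 := by
  obtain ⟨⟨e, b⟩, h⟩ := d
  cases b
  · have h1 : κ.onD ⟨(e, false), h⟩ = Y.rev (κ.onD ⟨(e, true), h⟩) := κ.onD_rev ⟨(e, true), h⟩
    rw [h1]; rfl
  · rfl

lemma mk_eq_mk_of_len_eq {Y : MarkedGraph n} {len len' : Y.E → ℝ} (h : ∀ e, 0 < len e)
    (h' : ∀ e, 0 < len' e) {c : ℝ} (hc : 0 < c) (heq : ∀ e, len' e = c * len e) :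
    CV.mk ⟨Y, len, h⟩ = CV.mk ⟨Y, len', h'⟩ :=
  Quotient.sound ⟨c, hc, GraphIso.refl _, fun d => heq d.1, [], rfl, fun w => by
    rw [GraphIso.hom_refl, ← FreeGroup.one_eq_mk]; simp⟩

namespace IsMultiTheta

variable (hX : X.IsMultiTheta) (hn : 2 ≤ n)
include hX

/-- The collapse of a multi-theta graph onto a rose collapses exactly one edge. -/
lemma exists_eq_singleton {Y : MarkedGraph n} (hY : Y.IsRose) {S : Set X.E}
    (κ : CollapseMap X.toFinGraph Y.toFinGraph S) : ∃ e, S = {e} := by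
  have := X.finE
  -- Counting oriented edges gives 2(n + 1 - |S|) = 2n.
  have h1 : Nat.card {d : X.Dart // d.1 ∉ S} = Nat.card Y.Dart := Nat.card_congr κ.onD
  have h2 : Nat.card {d : X.Dart // d.1 ∉ S} = Nat.card {i : X.E // i ∉ S} * 2 := by
    rw [← Nat.card_congr (Equiv.prodSubtypeFstEquivSubtypeProd (p := fun i : X.E => i ∉ S)
      (β := Bool)).symm, Nat.card_prod]
    simp
  have h3 : Nat.card Y.Dart = n * 2 := by rw [Nat.card_prod, hY.2]; simp
  have h4 := Set.ncard_add_ncard_compl S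
  rw [hX.2.1, ← Nat.card_coe_set_eq Sᶜ] at h4
  have h5 : Nat.card (Sᶜ : Set X.E) = Nat.card {i : X.E // i ∉ S} := rfl
  exact Set.ncard_eq_one.1 (by omega)

/-- Every rose obtained by a collapse has the same simplex as the standard one. -/
lemma simplex_subset_petalRose {Y : MarkedGraph n} (hY : Y.IsRose) {e : X.E}
    (h : X.IsCollapse Y {e}) : Y.simplex ⊆ (hX.petalRose hn e).simplex := by
  rintro _ ⟨len, hlen, rfl⟩
  obtain ⟨κ, r, hr, hκ⟩ := h
  have hYV : Subsingleton Y.V := (Nat.card_eq_one_iff_unique.1 hY.1).1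
  let φ := κ.graphIso (hX.petalCollapse e) Y.base (Unit.unit : Unit)
  -- The standard rose gets the lengths pulled back through `κ`. Its marking differs from the
  -- transported one by conjugation with the image of `r`, hence the inverse path.
  refine ⟨fun i => len (κ.onD ⟨(i.1, true), i.2⟩).1, fun i => hlen _, Quotient.sound
    ⟨1, one_pos, φ, fun d => ?_, FreeGroup.invRev (r.map φ.onD),
      isPath_of_subsingleton (petalGraph X.toFinGraph e) _ _ _,
      fun w => ?_⟩⟩
  · obtain ⟨d, rfl⟩ := κ.onD.surjective d
    rw [one_mul]
    show len (κ.onD ⟨((φ.onD (κ.onD d)).1.1, true), _⟩).1 = len (κ.onD d).1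
    rw [κ.onD_fst d]
    congr 3
    apply Subtype.ext
    simp only [φ, CollapseMap.graphIso, Equiv.trans_apply, Equiv.symm_apply_apply]
    rfl
  · have h1 : (hX.petalCollapse e).hom (X.marking w : FreeGroup X.E) =
        φ.hom (κ.hom (X.marking w : FreeGroup X.E)) := (κ.graphIso_hom _ _ _ _).symm
    have h2 : κ.hom (X.marking w : FreeGroup X.E) =
        (FreeGroup.mk r)⁻¹ * (Y.marking w : FreeGroup Y.E) * FreeGroup.mk r := by
      rw [hκ w]; group
    have h3 : (hX.petalCollapse e).hom (X.marking w : FreeGroup X.E) =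
        FreeGroup.mk (FreeGroup.invRev (r.map φ.onD)) * φ.hom (Y.marking w : FreeGroup Y.E) *
          (FreeGroup.mk (FreeGroup.invRev (r.map φ.onD)))⁻¹ := by
      rw [h1, h2, ← FreeGroup.inv_mk, ← φ.hom_mk, inv_inv, map_mul, map_mul, map_inv]
    exact h3

/-- `x` is the point of the simplex of `X` or of one of its rose-faces with edge lengths `a`. -/
inductive IsPoint : CV n → (X.E → ℝ) → Prop
  | ofPos (a : X.E → ℝ) (ha : ∀ i, 0 < a i) : IsPoint (CV.mk ⟨X, a, ha⟩) a
  | ofZero (a : X.E → ℝ) (e : X.E) (he : a e = 0)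
      (ha : ∀ i : (petalGraph X.toFinGraph e).E, 0 < a i.1) :
      IsPoint (CV.mk ⟨hX.petalRose hn e, fun i => a i.1, ha⟩) a

variable {hX hn}

lemma IsPoint.exists_represents {x : CV n} {a : X.E → ℝ} (h : IsPoint hX hn x a) :
    ∃ A, x = CV.mk A ∧ X.Represents a A := by
  cases h with
  | ofPos a ha => exact ⟨_, rfl, hX.represents ha⟩
  | ofZero a e he ha => exact ⟨_, rfl, hX.represents_petalRose hn he ha⟩

lemma IsPoint.isAdmissible {x : CV n} {a : X.E → ℝ} (h : IsPoint hX hn x a) :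
    IsAdmissible a := by
  obtain ⟨A, -, hA⟩ := h.exists_represents
  exact hA.admissible

lemma IsPoint.lipDist_eq [Fintype X.E] [DecidableEq X.E] {x y : CV n} {a b : X.E → ℝ}
    (hE : 3 ≤ Nat.card X.E) (hx : IsPoint hX hn x a) (hy : IsPoint hX hn y b) :
    CV.lipDist x y = dist (logRatios a) (logRatios b) := by
  obtain ⟨A, rfl, hA⟩ := hx.exists_represents
  obtain ⟨B, rfl, hB⟩ := hy.exists_represents
  exact MarkedMetricGraph.lipDist_eq_dist hX hE hA hB

lemma exists_isPoint_of_isAdmissible {a : X.E → ℝ} (ha : IsAdmissible a) :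
    ∃ x, IsPoint hX hn x a := by
  by_cases h : ∃ e, a e = 0
  · obtain ⟨e, he⟩ := h
    refine ⟨_, .ofZero a e he fun i => ?_⟩
    have hi : i.1 ≠ e := i.2
    have := ha.add_pos i.1 e hi
    linarith
  · push Not at h
    exact ⟨_, .ofPos a fun i => (ha.nonneg i).lt_of_ne (h i).symm⟩

/-- Points with proportional edge lengths coincide. -/
lemma IsPoint.eq_of_smul {x y : CV n} {a : X.E → ℝ} {c : ℝ} (hc : 0 < c)
    (hx : IsPoint hX hn x a) (hy : IsPoint hX hn y (c • a)) : x = y := by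
  generalize hb : c • a = b at hy
  have hb' : ∀ i, b i = c * a i := fun i => by rw [← hb]; rfl
  cases hx with
  | ofPos a ha =>
    cases hy with
    | ofPos b hbpos => exact mk_eq_mk_of_len_eq ha hbpos hc hb'
    | ofZero b e he hbpos => exact absurd ((hb' e).symm.trans he) (mul_pos hc (ha e)).ne'
  | ofZero a e he ha =>
    have hbe : b e = 0 := by rw [hb', he, mul_zero]
    cases hy with
    | ofPos b hbpos => exact absurd hbe (hbpos e).ne'
    | ofZero b k hk hbpos =>
      obtain rfl : e = k := by
        by_contra hne
        exact (hbpos ⟨e, hne⟩).ne' hbe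
      exact mk_eq_mk_of_len_eq _ _ hc fun i => hb' i.1

lemma IsPoint.mem_simplex {x : CV n} {a : X.E → ℝ} (h : IsPoint hX hn x a) (ha : ∀ i, 0 < a i) :
    x ∈ X.simplex := by
  cases h with
  | ofPos a ha => exact ⟨a, ha, rfl⟩
  | ofZero a e he _ => exact absurd he (ha e).ne'

lemma IsPoint.mem_simplex_petalRose {x : CV n} {a : X.E → ℝ} (h : IsPoint hX hn x a) {e : X.E}
    (he : a e = 0) : x ∈ (hX.petalRose hn e).simplex := by
  cases h with
  | ofPos a ha => exact absurd he (ha e).ne'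
  | ofZero a k hk ha =>
    obtain rfl : e = k := by
      by_contra hne
      exact (ha ⟨e, hne⟩).ne' he
    exact ⟨_, ha, rfl⟩

lemma exists_isPoint_of_mem_simplex {x : CV n} (h : x ∈ X.simplex) :
    ∃ a, (∀ i, 0 < a i) ∧ IsPoint hX hn x a := by
  obtain ⟨a, ha, rfl⟩ := h
  exact ⟨a, ha, .ofPos a ha⟩

lemma exists_isPoint_of_mem_petalRose {x : CV n} {e : X.E}
    (h : x ∈ (hX.petalRose hn e).simplex) : ∃ a, a e = 0 ∧ IsPoint hX hn x a := by
  classical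
  obtain ⟨len, hlen, rfl⟩ := h
  let a : X.E → ℝ := fun i => if hi : i ≠ e then len ⟨i, hi⟩ else 0
  have hae : a e = 0 := by simp [a]
  have ha : ∀ i : (petalGraph X.toFinGraph e).E, a i.1 = len i := fun i => dif_pos i.2
  refine ⟨a, hae, ?_⟩
  rw [mk_eq_mk_of_len_eq hlen (len' := fun i : (petalGraph X.toFinGraph e).E => a i.1) (fun i => (ha i).symm ▸ hlen i) one_pos
    fun i => (ha i).trans (one_mul _).symm]
  exact .ofZero a e hae _

/-- The points of the simplex with its rose-faces are those with admissible edge lengths. -/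
lemma mem_simplexWithRoseFaces_iff {x : CV n} :
    x ∈ X.simplexWithRoseFaces ↔ ∃ a, IsPoint hX hn x a := by
  constructor
  · rintro (h | ⟨_, ⟨Y, hY, ⟨S, hS⟩, rfl⟩, h⟩)
    · obtain ⟨a, -, ha⟩ := exists_isPoint_of_mem_simplex (hX := hX) (hn := hn) h
      exact ⟨a, ha⟩
    · obtain ⟨κ, hκ⟩ := hS
      obtain ⟨e, rfl⟩ := hX.exists_eq_singleton hY κ
      obtain ⟨a, -, ha⟩ := exists_isPoint_of_mem_petalRose
        (hX.simplex_subset_petalRose hn hY ⟨κ, hκ⟩ h)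
      exact ⟨a, ha⟩
  · rintro ⟨a, ha⟩
    cases ha with
    | ofPos a ha => exact Or.inl ⟨a, ha, rfl⟩
    | ofZero a e he ha => exact Or.inr ⟨_, hX.isRoseFace_petalRose hn e, ⟨_, ha, rfl⟩⟩

end IsMultiTheta

end MarkedGraph

/-! ### Proof of the theorem -/

open MarkedGraph MarkedGraph.IsMultiTheta in
theorem theorem7p1 (n : ℕ) (hn : 2 ≤ n) (X : MarkedGraph n) (hX : X.IsMultiTheta)
    (Φ : X.simplex → X.simplex) (hΦ : CV.IsIsometryOf X.simplex Φ) :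
    Φ X.centre = X.centre ∧
    (∃! Ψ : X.simplexWithRoseFaces → X.simplexWithRoseFaces, X.IsIsometricExtension Φ Ψ) ∧
    ∀ Ψ : X.simplexWithRoseFaces → X.simplexWithRoseFaces, X.IsIsometricExtension Φ Ψ →
      (∀ R : Set (CV n), X.IsRoseFace R →
        ∀ x : X.simplexWithRoseFaces, (x : CV n) ∈ R → (Ψ x : CV n) ∈ R) →
      (∀ R : Set (CV n), X.IsRoseFace R →
        ∀ x : X.simplexWithRoseFaces, (x : CV n) ∈ R → Ψ x = x) ∧
      ∀ x : X.simplex, Φ x = x := by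
  classical
  have := X.finE
  let _ := Fintype.ofFinite X.E
  have hE : 3 ≤ Nat.card X.E := by rw [hX.2.1]; omega
  choose a ha using fun x : X.simplexWithRoseFaces =>
    (mem_simplexWithRoseFaces_iff (hX := hX) (hn := hn)).1 x.2
  let τ : X.simplexWithRoseFaces → OffDiag X.E × OffDiag X.E → ℝ := fun x => logRatios (a x)
  have hinj : Function.Injective τ := fun x y hxy => by
    obtain ⟨c, hc, h⟩ := exists_smul_of_logRatios_eq hE (ha x).isAdmissible (ha y).isAdmissible hxy
    exact Subtype.ext ((ha x).eq_of_smul hc (h ▸ ha y))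
  let _ : MetricSpace X.simplexWithRoseFaces := MetricSpace.induced τ hinj inferInstance
  have hτ : Isometry τ := Isometry.of_dist_eq fun _ _ => rfl
  have hdist : ∀ x y : X.simplexWithRoseFaces, dist x y = CV.lipDist (x : CV n) y :=
    fun x y => ((ha x).lipDist_eq hE (ha y)).symm
  -- The coordinates do not depend on the chosen vector: two vectors of the same point are at the
  -- distance of that point from itself.
  have coord : ∀ (x : X.simplexWithRoseFaces) b, IsPoint hX hn (x : CV n) b →
      τ x = logRatios b := fun x b hb => by
    refine dist_eq_zero.1 ?_
    rw [← (ha x).lipDist_eq hE hb, (ha x).lipDist_eq hE (ha x), dist_self]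
  have point : ∀ (x : X.simplexWithRoseFaces) b, IsAdmissible b → τ x = logRatios b →
      IsPoint hX hn (x : CV n) b := fun x b hb hx => by
    obtain ⟨y, hy⟩ := exists_isPoint_of_isAdmissible (hX := hX) (hn := hn) hb
    have hyx : (⟨y, mem_simplexWithRoseFaces_iff.2 ⟨b, hy⟩⟩ : X.simplexWithRoseFaces) = x :=
      hinj ((coord _ b hy).trans hx.symm)
    rwa [← hyx]
  have hr : Set.range τ = logRatios '' {b : X.E → ℝ | IsAdmissible b} := by
    ext u
    constructor
    · rintro ⟨x, rfl⟩
      exact ⟨a x, (ha x).isAdmissible, rfl⟩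
    · rintro ⟨b, hb, rfl⟩
      obtain ⟨y, hy⟩ := exists_isPoint_of_isAdmissible (hX := hX) (hn := hn) hb
      exact ⟨⟨y, mem_simplexWithRoseFaces_iff.2 ⟨b, hy⟩⟩, coord _ b hy⟩
  have hpos : ∀ x : X.simplexWithRoseFaces, x ∈ positivePart τ ↔ (x : CV n) ∈ X.simplex := by
    refine fun x => ⟨?_, fun h => ?_⟩
    · rintro ⟨b, hb, hx⟩
      exact (point x b (isAdmissible_of_pos hb) hx.symm).mem_simplex hb
    · obtain ⟨b, hb, hx⟩ := exists_isPoint_of_mem_simplex (hX := hX) (hn := hn) h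
      exact ⟨b, hb, (coord x b hx).symm⟩
  have hface : ∀ e, ∀ x : X.simplexWithRoseFaces,
      x ∈ vanishingFace τ e ↔ (x : CV n) ∈ (hX.petalRose hn e).simplex := by
    refine fun e x => ⟨?_, fun h => ?_⟩
    · rintro ⟨b, ⟨hb, hb0⟩, hx⟩
      exact (point x b hb hx.symm).mem_simplex_petalRose hb0
    · obtain ⟨b, hb, hx⟩ := exists_isPoint_of_mem_petalRose h
      exact ⟨b, ⟨hx.isAdmissible, hb⟩, (coord x b hx).symm⟩
  have := completeSpace_of_range_eq hE hτ hr
  let ι : X.simplex → X.simplexWithRoseFaces := fun x => ⟨x, Or.inl x.2⟩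
  have hιinj : Function.Injective ι := fun x y hxy =>
    Subtype.ext (congrArg (fun z : X.simplexWithRoseFaces => (z : CV n)) hxy)
  have hι : DenseRange ι := by
    refine (dense_positivePart hτ hr).mono fun x hx => ?_
    exact ⟨⟨x, (hpos x).1 hx⟩, rfl⟩
  have ext_apply : ∀ Ψ, X.IsIsometricExtension Φ Ψ → ∀ x, Ψ (ι x) = ι (Φ x) :=
    fun Ψ hΨ x => Subtype.ext (hΨ.2 x)
  have equiv : ∀ Ψ, X.IsIsometricExtension Φ Ψ → ∃ Θ : X.simplexWithRoseFaces ≃ᵢ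
      X.simplexWithRoseFaces, ⇑Θ = Ψ ∧ ∀ x, Θ x ∈ positivePart τ ↔ x ∈ positivePart τ := by
    intro Ψ hΨ
    refine ⟨⟨Equiv.ofBijective Ψ hΨ.1.1, Isometry.of_dist_eq fun x y => ?_⟩, rfl, fun x => ?_⟩
    · rw [hdist, hdist]; exact hΨ.1.2 x y
    · change Ψ x ∈ positivePart τ ↔ x ∈ positivePart τ
      rw [hpos, hpos]
      refine ⟨fun h => ?_, fun h => ?_⟩
      -- Nothing outside the open simplex can enter it: `Φ` already covers the simplex and `Ψ` is
      -- injective.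
      · obtain ⟨z, hz⟩ := hΦ.1.2 ⟨Ψ x, h⟩
        have hzx : ι z = x := hΨ.1.1.1 (by rw [ext_apply Ψ hΨ, hz])
        rw [← hzx]; exact z.2
      · have h1 : Ψ x = ι (Φ ⟨x, h⟩) := ext_apply Ψ hΨ ⟨x, h⟩
        rw [h1]; exact (Φ ⟨x, h⟩).2
  obtain ⟨Ψ₀, hΨ₀⟩ : ∃ Ψ₀, X.IsIsometricExtension Φ Ψ₀ := by
    obtain ⟨Θ, hΘ⟩ := exists_isometryEquiv_extending hι (Equiv.ofBijective Φ hΦ.1) fun x y => by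
      rw [hdist, hdist]; exact hΦ.2 x y
    refine ⟨Θ, ⟨Θ.bijective, fun x y => ?_⟩, fun x => ?_⟩
    · rw [← hdist, ← hdist]; exact Θ.dist_eq x y
    · exact congrArg (fun z : X.simplexWithRoseFaces => (z : CV n)) (hΘ x)
  refine ⟨?_, ⟨Ψ₀, hΨ₀, fun Ψ hΨ => ?_⟩, fun Ψ hΨ hR => ?_⟩
  · obtain ⟨Θ, rfl, hΘ⟩ := equiv Ψ₀ hΨ₀
    have h1 := apply_eq_of_logRatios_const hE hτ hr Θ hΘ (x := ι X.centre)
      (coord _ _ (.ofPos (fun _ => 1) fun _ => one_pos))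
    exact hιinj ((ext_apply _ hΨ₀ X.centre).symm.trans h1)
  · obtain ⟨Θ, rfl, -⟩ := equiv Ψ hΨ
    obtain ⟨Θ₀, rfl, -⟩ := equiv Ψ₀ hΨ₀
    exact hι.equalizer Θ.continuous Θ₀.continuous (funext fun x =>
      (ext_apply _ hΨ x).trans (ext_apply _ hΨ₀ x).symm)
  · obtain ⟨Θ, rfl, hΘ⟩ := equiv Ψ hΨ
    have hid := apply_eq_of_mapsTo_vanishingFace hE hτ hr Θ hΘ fun e x hx =>
      (hface e _).2 (hR _ (hX.isRoseFace_petalRose hn e) x ((hface e x).1 hx))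
    exact ⟨fun _ _ x _ => hid x, fun x => hιinj ((ext_apply _ hΨ x).symm.trans (hid (ι x)))⟩
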